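/- **Setting.** Let $d\in\mathbb N$, $T>0$, $\Lambda\ge 0$. An ALE mapping with bound $\Lambda$ is a family of maps $\mathcal A_{h,t}:\Omega_0\to\Omega_t=\mathcal A_{h,t}(\Omega_0)\subset\mathbb R^d$, $t\in[0,T]$, on an open reference set $\Omega_0\subset\mathbb R^d$, Lipschitz in $t$ uniformly on $\Omega_0$, such that each $\mathcal A_{h,t}$ is a bijection onto an open set, $\det D_\xi\mathcal A_{h,t}>0$ a.e. in $\Omega_0$, and $\mathcal A_{h,t}\in W^{1,\infty}(\Omega_0)^d$, $\mathcal A_{h,t}^{-1}\in W^{1,\infty}(\Omega_t)^d$ with these functions and their first derivatives bounded by $\Lambda$. Let $\mu>0$, $\mu_T\ge 0$, let $u^*(t)\in W^{1,\infty}(\Omega_t)^d$ with $(\nabla\cdot u^*(t),q)_{L^2(\Omega_t)}=0$ for all $q\in L^2(\Omega_t)$, and let $f(t)\in H^{-1}(\Omega_t)^d=(H^1_0(\Omega_t)^d)'$ (dual of the full $H^1$ norm). Let $\Delta t=T/N$ with $N\ge 1$, $t^n=n\Delta t$, and $$\hat w_h^{n+1}=\frac{\mathcal A_{h,t^{n+1}}-\mathcal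 A_{h,t^n}}{\Delta t},\qquad w_h^{n+1}=\hat w_h^{n+1}\circ\mathcal A_{h,t^{n+1}}^{-1}.$$ At each level let $X_h(\Omega_{t^n})\subset H_0^1(\Omega_{t^n})^d$ and $Q_h(\Omega_{t^n})\subset L^2(\Omega_{t^n})$ be finite-dimensional, let $V_h(\Omega_{t^n})=\{v\in X_h(\Omega_{t^n}):(\nabla\cdot v,q)=0\ \forall q\in Q_h(\Omega_{t^n})\}$, and let $V_h(\Omega_{t^n})=\overline V_h\oplus\tilde V_h$ be a splitting into resolved large and small scales; write $v=\bar v+\tilde v$ accordingly. Let $u_h^0\in L^2(\Omega_{t^0})^d$ and, for $0\le n<N$, let $u_h^{n+1}\in V_h(\Omega_{t^{n+1}})$ solve the classical backward Euler scheme: for all $v_h\in V_h(\Omega_{t^{n+1}})$, $$\int_{\Omega_{t^{n+1}}}u_h^{n+1}\cdot v_h-\int_{\Omega_{t^n}}u_h^n\cdot\big(v_h\circ\mathcal A_{h,t^{n+1}}\circ\mathcal A_{h,t^n}^{-1}\big)+2\mu\Delta t\int_{\Omega_{t^{n+1}}}\nabla u_h^{n+1}:\nabla v_h+\mu_T\Delta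 t\int_{\Omega_{t^{n+1}}}\nabla\tilde u_h^{n+1}:\nabla\tilde v_h$$ $$+\Delta t\int_{\Omega_{t^{n+1}}}\nabla\cdot\big[(u^*(t^{n+1})-w_h^{n+1})\otimes u_h^{n+1}\big]\cdot v_h=\Delta t\,\langle f(t^{n+1}),v_h\rangle,$$ where $\nabla\cdot[b\otimes u]=(\nabla\cdot b)u+(b\cdot\nabla)u$. **Claim.** There is a constant $C>0$ depending only on $d$ and $\Lambda$, and, for all $T>0$, $L\ge0$, $\mu>0$, a constant $C'>0$ depending only on $d,\Lambda,T,L,\mu$, such that the following holds for all data as above with $\max_{n<N}\|D_\xi\hat w_h^{n+1}\|_{L^\infty(\Omega_0)}\le L$. If $\Delta t\le\overline{\Delta t}$, where for every $0\le n<N$ $$C\,(\overline{\Delta t})^2\,\|D_\xi\hat w_h^{n+1}\|_{L^\infty(\Omega_0)}\,\|D_\xi\mathcal A_{h,t^{n+1}}\|_{L^\infty(\Omega_0)}\,\|\nabla\cdot w_h^{n+1}\|_{L^\infty(\Omega_{t^{n+1}})}-\frac{\overline{\Delta t}}2\|\nabla\cdot u^*(t^{n+1})\|_{L^\infty(\Omega_{t^{n+1}})}\le\frac12,$$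 then for every $0\le n<N$ $$\|u_h^{n+1}\|_{L^2(\Omega_{t^{n+1}})}^2+2\mu\Delta t\sum_{i=0}^n\|\nabla u_h^{i+1}\|_{L^2(\Omega_{t^{i+1}})}^2+\mu_T\Delta t\sum_{i=0}^n\|\nabla\tilde u_h^{i+1}\|_{L^2(\Omega_{t^{i+1}})}^2\le C'\Big(\|u_h^0\|_{L^2(\Omega_{t^0})}^2+\Delta t\sum_{i=1}^{n+1}\|f(t^i)\|_{H^{-1}(\Omega_{t^i})}^2\Big).$$ -/

import Mathlib

open MeasureTheory Set
open scoped NNReal ENNReal ContDiff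

noncomputable section

namespace ALEVMS

/-- Euclidean space of dimension `d`. -/
abbrev E (d : ℕ) := EuclideanSpace ℝ (Fin d)

/-- Values of gradients of vector fields, with the Frobenius norm and inner product:
the `j`-th entry is the partial derivative `∂_j u`, a vector of `E d`. -/
abbrev GradVal (d : ℕ) := PiLp 2 (fun _ : Fin d => E d)

/-- The classical gradient of a vector field. -/
def classicalGrad {d : ℕ} (φ : E d → E d) (x : E d) : GradVal d :=
  WithLp.toLp 2 (fun j => fderiv ℝ φ x (EuclideanSpace.single j 1))

/-- Pairs (function, gradient) of square integrable fields on `Ω`, with the full `H¹` norm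
`(‖u‖² + ‖∇u‖²)^(1/2)`. -/
abbrev L2Pair {d : ℕ} (Ω : Set (E d)) :=
  WithLp 2 (Lp (E d) 2 (volume.restrict Ω) × Lp (GradVal d) 2 (volume.restrict Ω))

/-- The pairs `(φ, ∇φ)` with `φ` smooth and compactly supported in `Ω`. -/
def testPairs {d : ℕ} (Ω : Set (E d)) : Set (L2Pair Ω) :=
  {p | ∃ φ : E d → E d, ContDiff ℝ ∞ φ ∧ HasCompactSupport φ ∧ tsupport φ ⊆ Ω ∧
    (p.fst : E d → E d) =ᵐ[volume.restrict Ω] φ ∧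
    (p.snd : E d → GradVal d) =ᵐ[volume.restrict Ω] classicalGrad φ}

/-- `H¹₀(Ω)^d`: the closure of the smooth compactly supported fields in the `H¹` norm.
An element carries its function and its weak gradient. -/
def H10 {d : ℕ} (Ω : Set (E d)) : Submodule ℝ (L2Pair Ω) :=
  (Submodule.span ℝ (testPairs Ω)).topologicalClosure

/-- The function underlying an element of `H¹₀(Ω)^d`. -/
def toL2 {d : ℕ} {Ω : Set (E d)} (u : H10 Ω) : Lp (E d) 2 (volume.restrict Ω) := u.1.fst

/-- The weak gradient of an element of `H¹₀(Ω)^d`. -/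
def wgrad {d : ℕ} {Ω : Set (E d)} (u : H10 Ω) : Lp (GradVal d) 2 (volume.restrict Ω) :=
  u.1.snd

/-- The weak divergence of an element of `H¹₀(Ω)^d`. -/
def wdiv {d : ℕ} {Ω : Set (E d)} (u : H10 Ω) (x : E d) : ℝ := ∑ j, (wgrad u x) j j

/-- `H⁻¹(Ω)^d`, the dual of `H¹₀(Ω)^d`, with the dual norm. -/
abbrev HMinus1 {d : ℕ} (Ω : Set (E d)) := StrongDual ℝ (H10 Ω)

/-- `b ∈ W^{1,∞}(Ω)^d` (continuous representative) with `|b| ≤ K` and `|Db| ≤ K` on `Ω`: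
for an open set `Ω`, the second bound says that `b` is `K`-Lipschitz on each ball inside `Ω`. -/
def W1InfBound {d : ℕ} (K : ℝ≥0) (Ω : Set (E d)) (b : E d → E d) : Prop :=
  (∀ x ∈ Ω, ‖b x‖ ≤ K) ∧ ∀ x r, Metric.ball x r ⊆ Ω → LipschitzOnWith K b (Metric.ball x r)

/-- The `L^∞(Ω)` norm (essential supremum). -/
def lInfNorm {d : ℕ} {F : Type*} [NormedAddCommGroup F] (Ω : Set (E d)) (g : E d → F) : ℝ :=
  (eLpNorm g ∞ (volume.restrict Ω)).toReal

/-- The divergence of a (locally Lipschitz, hence almost everywhere differentiable) field. -/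
def divergence {d : ℕ} (b : E d → E d) (x : E d) : ℝ :=
  ∑ j, (fderiv ℝ b x (EuclideanSpace.single j 1)) j

/-- The family `A t : Ω₀ → Ω_t = A t '' Ω₀`, `t ∈ [0,T]`, is an ALE mapping: a bijection onto an
open set for each `t`, with `W^{1,∞}` norms of `A t` and of its inverse bounded by `Λ`,
orientation preserving, and Lipschitz in time. -/
structure IsALEMap {d : ℕ} (Ω₀ : Set (E d)) (T : ℝ) (Λ : ℝ≥0) (A : ℝ → E d → E d) : Prop where
  isOpen_ref : IsOpen Ω₀
  injOn : ∀ t ∈ Icc 0 T, InjOn (A t) Ω₀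
  isOpen_image : ∀ t ∈ Icc 0 T, IsOpen (A t '' Ω₀)
  w1inf : ∀ t ∈ Icc 0 T, W1InfBound Λ Ω₀ (A t)
  w1inf_inv : ∀ t ∈ Icc 0 T, W1InfBound Λ (A t '' Ω₀) (Function.invFunOn (A t) Ω₀)
  det_pos : ∀ t ∈ Icc 0 T, ∀ᵐ Y ∂(volume.restrict Ω₀), 0 < (fderiv ℝ (A t) Y).det
  lipschitz_time : ∃ K : ℝ≥0, ∀ Y ∈ Ω₀, LipschitzOnWith K (fun t => A t Y) (Icc 0 T)

/-- The time level `tⁿ = n Δt`. -/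
def node (Δt : ℝ) (n : ℕ) : ℝ := n * Δt

/-- The domain `Ω_{tⁿ}`. -/
abbrev dom {d : ℕ} (Ω₀ : Set (E d)) (A : ℝ → E d → E d) (Δt : ℝ) (n : ℕ) : Set (E d) :=
  A (node Δt n) '' Ω₀

/-- The discrete mesh velocity `ŵ_h^{n+1} = (A_{t^{n+1}} - A_{tⁿ}) / Δt` on the reference
domain. -/
def refMeshVel {d : ℕ} (A : ℝ → E d → E d) (Δt : ℝ) (n : ℕ) (Y : E d) : E d :=
  Δt⁻¹ • (A (node Δt (n + 1)) Y - A (node Δt n) Y)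

/-- The discrete mesh velocity `w_h^{n+1} = ŵ_h^{n+1} ∘ A_{t^{n+1}}⁻¹` on `Ω_{t^{n+1}}`. -/
def meshVel {d : ℕ} (Ω₀ : Set (E d)) (A : ℝ → E d → E d) (Δt : ℝ) (n : ℕ) (x : E d) : E d :=
  refMeshVel A Δt n (Function.invFunOn (A (node Δt (n + 1))) Ω₀ x)

/-- A function on `Ω_{t^{n+1}}` transported to `Ω_{tⁿ}` by the ALE maps:
`v ∘ A_{t^{n+1}} ∘ A_{tⁿ}⁻¹`. -/
def transportBack {d : ℕ} (Ω₀ : Set (E d)) (A : ℝ → E d → E d) (Δt : ℝ) (n : ℕ)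
    (v : E d → E d) (x : E d) : E d :=
  v (A (node Δt (n + 1)) (Function.invFunOn (A (node Δt n)) Ω₀ x))

/-- Discrete spaces on `Ω`: finite dimensional velocity and pressure spaces `X_h`, `Q_h`, and a
splitting `V_h = V̄_h ⊕ Ṽ_h` of the space of discretely divergence free functions
`V_h = {v ∈ X_h | (∇·v, q) = 0 for all q ∈ Q_h}` into resolved large and resolved small scales. -/
structure VMSSpace {d : ℕ} (Ω : Set (E d)) where
  X : Submodule ℝ (H10 Ω)
  Q : Submodule ℝ (Lp ℝ 2 (volume.restrict Ω))
  finite_X : FiniteDimensional ℝ X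
  finite_Q : FiniteDimensional ℝ Q
  large : Submodule ℝ (H10 Ω)
  small : Submodule ℝ (H10 Ω)
  disjoint : Disjoint large small
  mem_sup_iff : ∀ v : H10 Ω, v ∈ large ⊔ small ↔
    v ∈ X ∧ ∀ q ∈ Q, ∫ x in Ω, wdiv v x * q x = 0

/-- The convective term `∇·(b ⊗ u) = (∇·b) u + (b·∇) u`, for a field `b` and
`u ∈ H¹₀(Ω)^d`. -/
def convection {d : ℕ} {Ω : Set (E d)} (b : E d → E d) (u : H10 Ω) (x : E d) : E d :=
  divergence b x • toL2 u x + ∑ j, b x j • wgrad u x j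

/-- The velocity at level `n`: the initial value `u⁰` at level `0`, and `u^{n+1}` afterwards. -/
def levelFun {d : ℕ} {Ω₀ : Set (E d)} {A : ℝ → E d → E d} {Δt : ℝ}
    (u₀ : Lp (E d) 2 (volume.restrict (dom Ω₀ A Δt 0)))
    (u : (n : ℕ) → H10 (dom Ω₀ A Δt (n + 1))) : ℕ → E d → E d
  | 0 => u₀
  | n + 1 => toL2 (u n)

/-- `(u⁰, (ū^{n+1} + ũ^{n+1})_{0 ≤ n < N})` solves the classical backward Euler discretization of
the conservative ALE-VMS Oseen problem (all integrals of step `n` except the old mass term are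
over `Ω_{t^{n+1}}`). Here `uL n = ū^{n+1}` and `uS n = ũ^{n+1}` are the resolved large and small
scales at level `n + 1`. -/
structure IsBackwardEulerSolution {d : ℕ} (Ω₀ : Set (E d)) (A : ℝ → E d → E d) (Δt : ℝ) (N : ℕ)
    (μ μT : ℝ) (ustar : ℝ → E d → E d)
    (f : (t : ℝ) → HMinus1 (A t '' Ω₀))
    (S : (n : ℕ) → VMSSpace (dom Ω₀ A Δt (n + 1)))
    (u₀ : Lp (E d) 2 (volume.restrict (dom Ω₀ A Δt 0)))
    (uL uS : (n : ℕ) → H10 (dom Ω₀ A Δt (n + 1))) : Prop where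
  large_mem : ∀ n < N, uL n ∈ (S n).large
  small_mem : ∀ n < N, uS n ∈ (S n).small
  step : ∀ n < N, ∀ vL ∈ (S n).large, ∀ vS ∈ (S n).small,
    (∫ x in dom Ω₀ A Δt (n + 1), inner ℝ (toL2 (uL n + uS n) x) (toL2 (vL + vS) x))
    - (∫ x in dom Ω₀ A Δt n, inner ℝ (levelFun u₀ (fun k => uL k + uS k) n x)
        (transportBack Ω₀ A Δt n (toL2 (vL + vS)) x))
    + 2 * μ * Δt *
      (∫ x in dom Ω₀ A Δt (n + 1), inner ℝ (wgrad (uL n + uS n) x) (wgrad (vL + vS) x))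
    + μT * Δt * (∫ x in dom Ω₀ A Δt (n + 1), inner ℝ (wgrad (uS n) x) (wgrad vS x))
    + Δt * (∫ x in dom Ω₀ A Δt (n + 1),
        inner ℝ
          (convection (fun y => ustar (node Δt (n + 1)) y - meshVel Ω₀ A Δt n y)
            (uL n + uS n) x)
          (toL2 (vL + vS) x))
    = Δt * f (node Δt (n + 1)) (vL + vS)

end ALEVMS

end

noncomputable section

namespace ALEVMS

/-! Test the scheme with `u^{n+1}` itself. Three terms have no sign and must be absorbed.

Convection. For `b = u* - w` integration by parts gives `∫ (∇·(b ⊗ u))·u = ½ ∫ (∇·b)|u|²`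
(`integral_convection`). Orthogonality to all of `L²` forces `∇·u* = 0` almost everywhere
(`ae_divergence_eq_zero`), so only `-½ ∫ (∇·w)|u|²` survives.

Old mass term. Pulled back to `Ω₀`, the test function transported to `Ω_{tⁿ}` has squared norm
weighted by `|det DA_{tⁿ}|`. Since `DA_{tⁿ} = (1 - B) DA_{t^{n+1}}` with `B = Δt Dŵ
(DA_{t^{n+1}})⁻¹`, this weight is at most `1 + c‖B‖` times `|det DA_{t^{n+1}}|`
(`lintegral_transport_le`): the domains cost a factor `1 + O(Δt)`.

Force. Young's inequality with a weight `ε` small against `μ` and `1/T` (`apply_le_young`).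

Write `D` for the supremum of `|∇·w|`. From `D ≤ dΛ‖Dŵ‖` and `1 ≤ Λ‖DA‖` follows `D² ≤
dΛ²‖Dŵ‖‖DA‖D`, so the time step restriction is a bound on `(Δt D)²` and gives `Δt D ≤ 1/2`
(`mul_lInfNorm_divergence_meshVel_le`). Absorption thus works for steps of any admissible length:
short ones lose a factor `1 + O(Δt)`, long ones a fixed factor, and both are at most `exp(κΔt)`
(`energy_step`). As `NΔt = T`, iteration costs at most `exp(κT)` (`discrete_gronwall`). -/

/-! ### Determinants near the identity; Lipschitz functions of compact support. -/

/-- On bounded sets of operators, `|det (1 - B)|` exceeds `1` by at most a multiple of `‖B‖`. -/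
theorem exists_abs_det_one_sub_le (d : ℕ) (R : ℝ) :
    ∃ c : ℝ, 0 ≤ c ∧ ∀ B : E d →L[ℝ] E d, ‖B‖ ≤ R →
      |(ContinuousLinearMap.id ℝ (E d) - B).det| ≤ 1 + c * ‖B‖ := by
  let b := (EuclideanSpace.basisFun (Fin d) ℝ).toBasis
  have hdet : ContDiff ℝ 1 (fun B : E d →L[ℝ] E d => (ContinuousLinearMap.id ℝ (E d) - B).det) := by
    -- The determinant is a polynomial in the matrix entries, hence Lipschitz on the compact ball of
    -- radius `R`.
    have h : (fun B : E d →L[ℝ] E d => (ContinuousLinearMap.id ℝ (E d) - B).det) =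
        fun B => ∑ σ : Equiv.Perm (Fin d), (Equiv.Perm.sign σ : ℤ) •
          ∏ i, (EuclideanSpace.proj (𝕜 := ℝ) (σ i)
            ((ContinuousLinearMap.id ℝ (E d) - B) (EuclideanSpace.single i 1))) := by
      funext B
      rw [ContinuousLinearMap.det, ← LinearMap.det_toMatrix b, Matrix.det_apply]
      refine Finset.sum_congr rfl fun σ _ => ?_
      congr 1
    rw [h]
    fun_prop
  obtain ⟨K, hK⟩ := (hdet.locallyLipschitz.locallyLipschitzOn
    (s := Metric.closedBall 0 R)).exists_lipschitzOnWith_of_compact (isCompact_closedBall _ _)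
  refine ⟨K, K.2, fun B hB => ?_⟩
  have h0 : (0 : E d →L[ℝ] E d) ∈ Metric.closedBall 0 R := by
    simpa using (norm_nonneg B).trans hB
  have hB' : B ∈ Metric.closedBall 0 R := by simpa using hB
  have h := hK.dist_le_mul B hB' 0 h0
  have h1 : (ContinuousLinearMap.id ℝ (E d) - 0).det = 1 := by
    simp [ContinuousLinearMap.det]
  rw [Real.dist_eq, h1, dist_zero_right] at h
  have h2 := abs_sub_abs_le_abs_sub (ContinuousLinearMap.id ℝ (E d) - B).det 1
  simp only [abs_one] at h2
  linarith

/-- A locally Lipschitz function of compact support is Lipschitz. -/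
theorem lipschitzWith_of_locallyLipschitz_of_hasCompactSupport {F G : Type*}
    [NormedAddCommGroup F] [ProperSpace F] [NormedAddCommGroup G] {g : F → G}
    (hg : LocallyLipschitz g) (hc : HasCompactSupport g) : ∃ K, LipschitzWith K g := by
  obtain ⟨R, hR⟩ := hc.isCompact.isBounded.subset_closedBall (0 : F)
  obtain ⟨K, hK⟩ := (hg.locallyLipschitzOn
    (s := Metric.closedBall 0 (R + 1))).exists_lipschitzOnWith_of_compact (isCompact_closedBall _ _)
  obtain ⟨M, hM⟩ := hc.exists_bound_of_continuous hg.continuous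
  have hM0 : 0 ≤ M := (norm_nonneg _).trans (hM 0)
  -- The margin 1 around the support makes `‖x - y‖ ≥ 1` whenever `g x ≠ 0`, so the sup bound `M`
  -- serves as a Lipschitz constant.
  have key : ∀ x y, y ∉ Metric.closedBall (0 : F) (R + 1) → ‖g x - g y‖ ≤ M * ‖x - y‖ := by
    intro x y hy
    have hyt : y ∉ tsupport g := fun h => hy (Metric.closedBall_subset_closedBall (by simp) (hR h))
    rw [image_eq_zero_of_notMem_tsupport hyt, sub_zero]
    by_cases hx : x ∈ tsupport g
    · have h1 := hR hx
      simp only [Metric.mem_closedBall, dist_zero_right, not_le] at h1 hy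
      have h2 := norm_sub_norm_le y x
      rw [norm_sub_rev] at h2
      have : 1 ≤ ‖x - y‖ := by linarith
      nlinarith [hM x]
    · rw [image_eq_zero_of_notMem_tsupport hx, norm_zero]
      positivity
  refine ⟨max K M.toNNReal, LipschitzWith.of_dist_le_mul fun x y => ?_⟩
  rw [dist_eq_norm, dist_eq_norm]
  have e : ((max K M.toNNReal : ℝ≥0) : ℝ) = max (K : ℝ) M := by simp [hM0]
  rw [e]
  by_cases hy : y ∈ Metric.closedBall (0 : F) (R + 1)
  · by_cases hx : x ∈ Metric.closedBall (0 : F) (R + 1)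
    · refine (hK.norm_sub_le hx hy).trans ?_
      gcongr
      exact le_max_left _ _
    · rw [norm_sub_rev, norm_sub_rev x]
      refine (key y x hx).trans ?_
      gcongr
      exact le_max_right _ _
  · refine (key x y hy).trans ?_
    gcongr
    exact le_max_right _ _

/-! ### Rademacher's theorem and null sets for locally Lipschitz maps. -/

section LocallyLipschitz

variable {F G : Type*} [NormedAddCommGroup F] [NormedSpace ℝ F]
  [NormedAddCommGroup G] [NormedSpace ℝ G]

/-- Rademacher's theorem for locally Lipschitz functions on an open set. -/
theorem ae_differentiableAt_of_locallyLipschitzOn [FiniteDimensional ℝ F] [FiniteDimensional ℝ G]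
    [MeasurableSpace F] [BorelSpace F] {μ : Measure F} [μ.IsAddHaarMeasure] {Ω : Set F}
    (hΩ : IsOpen Ω) {f : F → G} (hf : LocallyLipschitzOn Ω f) :
    ∀ᵐ x ∂(μ.restrict Ω), DifferentiableAt ℝ f x := by
  rw [ae_restrict_iff' hΩ.measurableSet, ae_iff]
  refine measure_null_of_locally_null _ fun x hx => ?_
  simp only [mem_ofPred_eq, Classical.not_imp] at hx
  obtain ⟨K, t, ht, hKt⟩ := hf hx.1
  rw [hΩ.nhdsWithin_eq hx.1] at ht
  obtain ⟨u, hut, hu, hxu⟩ := mem_nhds_iff.1 ht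
  refine ⟨_, inter_mem_nhdsWithin _ (hu.mem_nhds hxu), ?_⟩
  have h := (hKt.mono hut).ae_differentiableWithinAt_of_mem (μ := μ)
  refine measure_mono_null ?_ (ae_iff.1 h)
  rintro y ⟨hy, hyu⟩
  simp only [mem_ofPred_eq, Classical.not_imp] at hy ⊢
  exact ⟨hyu, fun hd => hy.2 (hd.differentiableAt (hu.mem_nhds hyu))⟩

/-- A locally Lipschitz map maps null sets to null sets. -/
theorem measure_image_eq_zero_of_locallyLipschitzOn [FiniteDimensional ℝ F]
    [MeasurableSpace F] [BorelSpace F] (μ : Measure F) [μ.IsAddHaarMeasure] {Ω : Set F}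
    {f : F → F} (hf : LocallyLipschitzOn Ω f) {s : Set F} (hs : s ⊆ Ω)
    (h0 : μ s = 0) : μ (f '' s) = 0 := by
  -- Haar and Hausdorff measure have the same null sets, and Lipschitz maps control Hausdorff
  -- measure on each piece of a countable cover.
  have hac1 : μ ≪ μH[Module.finrank ℝ F] :=  Measure.absolutelyContinuous_isAddHaarMeasure _ _
  have hac2 : μH[Module.finrank ℝ F] ≪ μ := Measure.absolutelyContinuous_isAddHaarMeasure _ _
  choose! K t ht hKt using fun x (hx : x ∈ s) => hf (hs hx)
  have ht' : ∀ x ∈ s, t x ∩ s ∈ nhdsWithin x s := fun x hx =>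
    Filter.inter_mem (nhdsWithin_mono x hs (ht x hx)) self_mem_nhdsWithin
  obtain ⟨c, hcs, hc, hcov⟩ := TopologicalSpace.countable_cover_nhdsWithin ht'
  have : f '' s ⊆ ⋃ x ∈ c, f '' (t x ∩ s) := by
    rw [← image_iUnion₂]
    exact image_mono hcov
  refine measure_mono_null this ((measure_biUnion_null_iff hc).2 fun x hx => hac1 ?_)
  have h1 := ((hKt x (hcs hx)).mono (inter_subset_left (t := s))).hausdorffMeasure_image_le
    (d := Module.finrank ℝ F) (Nat.cast_nonneg _)
  rw [hac2 (measure_mono_null inter_subset_right h0), mul_zero] at h1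
  exact le_antisymm h1 bot_le

end LocallyLipschitz

theorem W1InfBound.locallyLipschitzOn {d : ℕ} {K : ℝ≥0} {Ω : Set (E d)} {b : E d → E d}
    (hΩ : IsOpen Ω) (h : W1InfBound K Ω b) : LocallyLipschitzOn Ω b := by
  intro x hx
  obtain ⟨r, hr, hb⟩ := Metric.isOpen_iff.1 hΩ x hx
  exact ⟨K, _, mem_nhdsWithin_of_mem_nhds (Metric.ball_mem_nhds x hr), h.2 x r hb⟩

/-- Valid at every point, since `fderiv` is zero where `b` is not differentiable. -/
theorem W1InfBound.norm_fderiv_le {d : ℕ} {K : ℝ≥0} {Ω : Set (E d)} {b : E d → E d}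
    (hΩ : IsOpen Ω) (h : W1InfBound K Ω b) {x : E d} (hx : x ∈ Ω) : ‖fderiv ℝ b x‖ ≤ K := by
  obtain ⟨r, hr, hb⟩ := Metric.isOpen_iff.1 hΩ x hx
  exact norm_fderiv_le_of_lipschitzOn ℝ (Metric.ball_mem_nhds x hr) (h.2 x r hb)

/-! ### Bi-Lipschitz maps: invertible derivatives and change of variables. -/

/-- A homeomorphism of open sets which together with its inverse is locally Lipschitz, with
first derivatives of the map and of its inverse bounded by `Λ`. -/
structure IsBiLipschitz {d : ℕ} (Λ : ℝ≥0) (Ω : Set (E d)) (a : E d → E d) : Prop where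
  isOpen : IsOpen Ω
  injOn : InjOn a Ω
  isOpen_image : IsOpen (a '' Ω)
  bound : W1InfBound Λ Ω a
  bound_inv : W1InfBound Λ (a '' Ω) (Function.invFunOn a Ω)

namespace IsBiLipschitz

variable {d : ℕ} {Λ : ℝ≥0} {Ω : Set (E d)} {a : E d → E d}

theorem invFunOn_apply (h : IsBiLipschitz Λ Ω a) {ξ : E d} (hξ : ξ ∈ Ω) :
    Function.invFunOn a Ω (a ξ) = ξ := h.injOn.leftInvOn_invFunOn hξ

theorem locallyLipschitzOn (h : IsBiLipschitz Λ Ω a) : LocallyLipschitzOn Ω a :=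
  h.bound.locallyLipschitzOn h.isOpen

theorem continuousAt (h : IsBiLipschitz Λ Ω a) {ξ : E d} (hξ : ξ ∈ Ω) : ContinuousAt a ξ :=
  h.locallyLipschitzOn.continuousOn.continuousAt (h.isOpen.mem_nhds hξ)

/-- The derivative of a bi-Lipschitz map is invertible, with inverse bounded by `Λ`. -/
theorem exists_fderiv_eq (h : IsBiLipschitz Λ Ω a) {ξ : E d} (hξ : ξ ∈ Ω)
    (hd : DifferentiableAt ℝ a ξ) :
    ∃ e : E d ≃L[ℝ] E d, fderiv ℝ a ξ = e ∧ ‖(e.symm : E d →L[ℝ] E d)‖ ≤ Λ ∧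
      HasFDerivAt (Function.invFunOn a Ω) (e.symm : E d →L[ℝ] E d) (a ξ) := by
  obtain ⟨r, hr, hb⟩ := Metric.isOpen_iff.1 h.isOpen_image (a ξ) (mem_image_of_mem a hξ)
  have hL := h.bound_inv.2 _ _ hb
  have hev : ∀ᶠ y in nhds ξ, y ∈ Ω ∧ a y ∈ Metric.ball (a ξ) r :=
    (h.isOpen.mem_nhds hξ |> Filter.eventually_of_mem <| fun _ => id).and
      ((h.continuousAt hξ).eventually (Metric.ball_mem_nhds _ hr))
  -- The Lipschitz bound of the inverse near `a ξ` gives `‖t v‖ ≤ Λ ‖a (ξ + t v) - a ξ‖`; divide by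
  -- `|t|` and let `t → 0`.
  have hanti : ∀ v, ‖v‖ ≤ Λ * ‖fderiv ℝ a ξ v‖ := by
    intro v
    have hline := hd.hasFDerivAt.hasLineDerivAt v
    have ht := (hasDerivAt_iff_tendsto_slope_zero.1 hline).norm.const_mul (Λ : ℝ)
    refine ge_of_tendsto ht ?_
    have hc : Filter.Tendsto (fun t : ℝ => ξ + t • v) (nhdsWithin 0 {0}ᶜ) (nhds ξ) := by
      have : Filter.Tendsto (fun t : ℝ => ξ + t • v) (nhds 0) (nhds (ξ + (0 : ℝ) • v)) :=
        (by fun_prop : Continuous fun t : ℝ => ξ + t • v).tendsto 0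
      rw [zero_smul, add_zero] at this
      exact this.mono_left nhdsWithin_le_nhds
    filter_upwards [hc.eventually hev, self_mem_nhdsWithin] with t ht htne
    have h1 := hL.norm_sub_le ht.2 (Metric.mem_ball_self hr)
    rw [h.invFunOn_apply ht.1, h.invFunOn_apply hξ, add_sub_cancel_left, norm_smul] at h1
    have ht0 : 0 < ‖t‖ := norm_pos_iff.2 htne
    simp only [zero_add, zero_smul, add_zero, norm_smul, norm_inv]
    rw [← mul_assoc, mul_comm _ (‖t‖⁻¹), mul_assoc, inv_mul_eq_div, le_div_iff₀ ht0, mul_comm]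
    exact h1
  have hinj : Function.Injective (fderiv ℝ a ξ) := by
    rw [injective_iff_map_eq_zero]
    intro v hv
    have := hanti v
    rw [hv, norm_zero, mul_zero] at this
    exact norm_le_zero_iff.1 this
  let e : E d ≃L[ℝ] E d :=
    (LinearEquiv.ofInjectiveEndo (fderiv ℝ a ξ : E d →ₗ[ℝ] E d) hinj).toContinuousLinearEquiv
  have he : fderiv ℝ a ξ = e := by ext1 v; rfl
  refine ⟨e, he, ContinuousLinearMap.opNorm_le_bound _ Λ.2 fun v => ?_, ?_⟩
  · have := hanti (e.symm v)
    rw [he] at this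
    simpa using this
  · refine HasFDerivAt.of_local_left_inverse (f := a) ?_ ?_ ?_
    · exact hL.continuousOn.continuousAt (Metric.ball_mem_nhds _ hr)
    · rw [h.invFunOn_apply hξ, ← he]
      exact hd.hasFDerivAt
    · filter_upwards [h.isOpen_image.mem_nhds (mem_image_of_mem a hξ)] with y hy
      exact Function.invFunOn_eq hy

/-- A property that holds almost everywhere in `Ω` holds almost everywhere in the image. -/
theorem ae_image (h : IsBiLipschitz Λ Ω a) {p : E d → Prop}
    (hp : ∀ᵐ ξ ∂(volume.restrict Ω), p ξ) :
    ∀ᵐ x ∂(volume.restrict (a '' Ω)), ∃ ξ ∈ Ω, a ξ = x ∧ p ξ := by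
  rw [ae_restrict_iff' h.isOpen.measurableSet, ae_iff] at hp
  rw [ae_restrict_iff' h.isOpen_image.measurableSet, ae_iff]
  refine measure_mono_null ?_ (measure_image_eq_zero_of_locallyLipschitzOn volume
    h.locallyLipschitzOn (s := {ξ | ¬(ξ ∈ Ω → p ξ)}) (fun ξ hξ => ?_) hp)
  · intro x hx
    simp only [mem_ofPred_eq, Classical.not_imp, not_exists, not_and] at hx
    obtain ⟨⟨ξ, hξ, rfl⟩, hx⟩ := hx
    exact mem_image_of_mem a (by simpa using ⟨hξ, hx ξ hξ rfl⟩)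
  · simp only [mem_ofPred_eq, Classical.not_imp] at hξ
    exact hξ.1

theorem ae_differentiableAt (h : IsBiLipschitz Λ Ω a) :
    ∀ᵐ ξ ∂(volume.restrict Ω), DifferentiableAt ℝ a ξ :=
  ae_differentiableAt_of_locallyLipschitzOn h.isOpen h.locallyLipschitzOn

/-- Change of variables. -/
theorem lintegral_image (h : IsBiLipschitz Λ Ω a) (g : E d → ℝ≥0∞) :
    ∫⁻ x in a '' Ω, g x =
      ∫⁻ ξ in Ω, ENNReal.ofReal |(fderiv ℝ a ξ).det| * g (a ξ) := by
  set s := Ω ∩ {ξ | DifferentiableAt ℝ a ξ} with hs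
  have hsm : MeasurableSet s := h.isOpen.measurableSet.inter (measurableSet_of_differentiableAt ℝ a)
  have hae := h.ae_differentiableAt
  have h1 : (volume.restrict Ω : Measure (E d)) = volume.restrict s := by
    refine Measure.restrict_congr_set ?_
    rw [ae_restrict_iff' h.isOpen.measurableSet] at hae
    filter_upwards [hae] with ξ hξ
    exact propext ⟨fun hh => ⟨hh, hξ hh⟩, fun hh => hh.1⟩
  -- Discarding the non-differentiability points is harmless in the image too, because `a` preserves
  -- null sets.
  have h2 : (volume.restrict (a '' Ω) : Measure (E d)) = volume.restrict (a '' s) := by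
    refine Measure.restrict_congr_set ?_
    have := h.ae_image hae
    rw [ae_restrict_iff' h.isOpen_image.measurableSet] at this
    filter_upwards [this] with x hx
    refine propext ⟨fun hh => ?_, fun hh => image_mono inter_subset_left hh⟩
    obtain ⟨ξ, hξ, rfl, hd⟩ := hx hh
    exact mem_image_of_mem a ⟨hξ, hd⟩
  rw [h1, h2]
  exact lintegral_image_eq_lintegral_abs_det_fderiv_mul volume hsm
    (fun x hx => hx.2.hasFDerivAt.hasFDerivWithinAt) (h.injOn.mono inter_subset_left) g

end IsBiLipschitz

/-- Comparison of the integrals of a function transported between two images of the same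
reference domain. -/
theorem lintegral_transport_le {d : ℕ} {Λ : ℝ≥0} {Ω : Set (E d)} {a b : E d → E d} {c R : ℝ}
    (hc : ∀ B : E d →L[ℝ] E d, ‖B‖ ≤ R → |(ContinuousLinearMap.id ℝ (E d) - B).det| ≤ 1 + c * ‖B‖)
    (hc0 : 0 ≤ c) (ha : IsBiLipschitz Λ Ω a) (hb : IsBiLipschitz Λ Ω b) {δ : ℝ}
    (hδ : ∀ᵐ ξ ∂(volume.restrict Ω), ‖fderiv ℝ (fun η => b η - a η) ξ‖ ≤ δ) (hR : δ * Λ ≤ R)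
    (g : E d → ℝ≥0∞) :
    ∫⁻ x in a '' Ω, g (b (Function.invFunOn a Ω x)) ≤
      ENNReal.ofReal (1 + c * (δ * Λ)) * ∫⁻ x in b '' Ω, g x := by
  rw [ha.lintegral_image, hb.lintegral_image, ← lintegral_const_mul' _ _ ENNReal.ofReal_ne_top]
  refine lintegral_mono_ae ?_
  filter_upwards [ha.ae_differentiableAt, hb.ae_differentiableAt, hδ,
    ae_restrict_mem ha.isOpen.measurableSet] with ξ hda hdb hξ hΩ
  obtain ⟨e, he, hes, -⟩ := hb.exists_fderiv_eq hΩ hdb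
  rw [ha.invFunOn_apply hΩ, ← mul_assoc, fderiv_fun_sub hdb hda] at *
  gcongr
  have hδ0 : 0 ≤ δ := (norm_nonneg _).trans hξ
  -- `B` is the relative change of the two Jacobians: `Da = (1 - B) Db`.
  set B := (fderiv ℝ b ξ - fderiv ℝ a ξ) ∘L (e.symm : E d →L[ℝ] E d) with hB
  have hBn : ‖B‖ ≤ δ * Λ := (ContinuousLinearMap.opNorm_comp_le _ _).trans (by gcongr)
  have hfac : fderiv ℝ a ξ = (ContinuousLinearMap.id ℝ (E d) - B) ∘L fderiv ℝ b ξ := by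
    ext1 v
    simp [hB, he]
  rw [← ENNReal.ofReal_mul (by positivity), hfac]
  have hdet : ((ContinuousLinearMap.id ℝ (E d) - B) ∘L fderiv ℝ b ξ).det =
      (ContinuousLinearMap.id ℝ (E d) - B).det * (fderiv ℝ b ξ).det := LinearMap.det_comp _ _
  rw [hdet, abs_mul]
  gcongr
  refine (hc B (hBn.trans hR)).trans ?_
  gcongr

/-! ### Integration by parts in `H¹₀` and skew-symmetry of convection. -/

section LocallyLipschitz

variable {X Y Z : Type*} [PseudoEMetricSpace X] [PseudoEMetricSpace Y] [PseudoEMetricSpace Z]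

theorem LocallyLipschitzOn.comp' {f : Y → Z} {g : X → Y} {s : Set X} {t : Set Y}
    (hf : LocallyLipschitzOn t f) (hg : LocallyLipschitzOn s g) (hm : MapsTo g s t) :
    LocallyLipschitzOn s (f ∘ g) := by
  intro x hx
  obtain ⟨Kg, v, hv, hgv⟩ := hg hx
  obtain ⟨Kf, u, hu, hfu⟩ := hf (hm hx)
  refine ⟨Kf * Kg, v ∩ g ⁻¹' u, Filter.inter_mem hv ?_, hfu.comp (hgv.mono inter_subset_left)
    ((mapsTo_preimage g u).mono_left inter_subset_right)⟩
  exact (hg.continuousOn x hx).tendsto_nhdsWithin hm hu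

theorem LocallyLipschitzOn.prodMk' {f : X → Y} {g : X → Z} {s : Set X}
    (hf : LocallyLipschitzOn s f) (hg : LocallyLipschitzOn s g) :
    LocallyLipschitzOn s fun x => (f x, g x) := by
  intro x hx
  obtain ⟨Kf, t₁, h₁, hf'⟩ := hf hx
  obtain ⟨Kg, t₂, h₂, hg'⟩ := hg hx
  exact ⟨max Kf Kg, t₁ ∩ t₂, Filter.inter_mem h₁ h₂,
    (hf'.mono inter_subset_left).prodMk (hg'.mono inter_subset_right)⟩

theorem _root_.ContDiff.comp_locallyLipschitzOn {F G : Type*} [NormedAddCommGroup F]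
    [NormedSpace ℝ F] [NormedAddCommGroup G] [NormedSpace ℝ G] {f : F → G} {g : X → F} {s : Set X}
    (hf : ContDiff ℝ 1 f) (hg : LocallyLipschitzOn s g) : LocallyLipschitzOn s (f ∘ g) :=
  LocallyLipschitzOn.comp' (t := univ) hf.locallyLipschitz.locallyLipschitzOn hg (mapsTo_univ _ _)

end LocallyLipschitz

/-- Integration by parts for the energy density of a test field against a locally Lipschitz
coefficient. -/
theorem integral_lineDeriv_test {d : ℕ} {Ω : Set (E d)} (hΩ : IsOpen Ω) {β β' : E d → ℝ}
    (hβ : LocallyLipschitzOn Ω β) {e : E d}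
    (hβ' : ∀ᵐ x ∂(volume.restrict Ω), HasLineDerivAt ℝ β (β' x) x e)
    {φ : E d → E d} (hφ : ContDiff ℝ ∞ φ) (hc : HasCompactSupport φ) (hs : tsupport φ ⊆ Ω) :
    ∫ x in Ω, (β' x * ‖φ x‖ ^ 2 + 2 * (β x * inner ℝ (φ x) (fderiv ℝ φ x e))) = 0 := by
  set g : E d → ℝ := fun x => β x * ‖φ x‖ ^ 2 with hg
  -- Nothing is known about `β` outside `Ω`; `g` vanishes near each such point because the support
  -- of `φ` lies in `Ω`.
  have hgz : ∀ x ∉ tsupport φ, g =ᶠ[nhds x] 0 := by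
    intro x hx
    filter_upwards [(isClosed_tsupport φ).isOpen_compl.mem_nhds hx] with y hy
    simp [hg, image_eq_zero_of_notMem_tsupport hy]
  have hglip : LocallyLipschitz g := by
    intro x
    by_cases hx : x ∈ tsupport φ
    · have h1 : LocallyLipschitzOn Ω g := by
        have h2 : ContDiff ℝ 1 (fun p : ℝ × E d => p.1 * ‖p.2‖ ^ 2) := by
          refine contDiff_fst.mul ?_
          exact contDiff_snd.norm_sq ℝ
        exact h2.comp_locallyLipschitzOn (LocallyLipschitzOn.prodMk' hβ
          ((hφ.of_le (by simp)).locallyLipschitz.locallyLipschitzOn))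
      obtain ⟨K, t, ht, hK⟩ := h1 (hs hx)
      rw [hΩ.nhdsWithin_eq (hs hx)] at ht
      exact ⟨K, t, ht, hK⟩
    · refine ⟨0, _, hgz x hx, ?_⟩
      intro y hy z hz
      have hy' : g y = 0 := hy
      have hz' : g z = 0 := hz
      simp [hy', hz']
  have hgc : HasCompactSupport g := hc.mono' fun x hx => by
    by_contra h
    exact hx (hgz x h).self_of_nhds
  obtain ⟨K, hK⟩ := lipschitzWith_of_locallyLipschitz_of_hasCompactSupport hglip hgc
  -- Integration by parts against the constant 1.
  have hint : ∫ x, lineDeriv ℝ g x e = 0 := by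
    have h := LipschitzWith.integral_lineDeriv_mul_eq (μ := (volume : Measure (E d)))
      (LipschitzWith.const (α := E d) (1 : ℝ)) hK hgc (-e)
    simpa [lineDeriv] using h.symm
  rw [← setIntegral_eq_integral_of_forall_compl_eq_zero (s := Ω)] at hint
  · rw [← hint]
    refine integral_congr_ae ?_
    filter_upwards [hβ'] with x hx
    have hφ' : HasLineDerivAt ℝ φ (fderiv ℝ φ x e) x e :=
      ((hφ.differentiable (by simp)) x).hasFDerivAt.hasLineDerivAt e
    have h : HasLineDerivAt ℝ g
        (β' x * ‖φ x‖ ^ 2 + 2 * (β x * inner ℝ (φ x) (fderiv ℝ φ x e))) x e := by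
      unfold HasLineDerivAt at *
      have := hx.mul hφ'.norm_sq
      simp only [zero_smul, add_zero] at this
      rw [mul_left_comm]
      exact this
    exact h.lineDeriv.symm
  · intro x hx
    have h0 := hgz x (fun h => hx (hs h))
    rw [h0.lineDeriv_eq]
    simp [lineDeriv]

/-- Test pairs already form a subspace, so `H10` is the closure of the test pairs themselves. This
matters because the identity extended by density below is quadratic and does not pass to linear
spans. -/
theorem span_testPairs {d : ℕ} {Ω : Set (E d)} :
    (Submodule.span ℝ (testPairs Ω) : Set (L2Pair Ω)) = testPairs Ω := by
  refine Subset.antisymm (fun p hp => ?_) Submodule.subset_span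
  induction hp using Submodule.span_induction with
  | mem p hp => exact hp
  | zero =>
    refine ⟨0, contDiff_const, HasCompactSupport.zero, by simp, ?_, ?_⟩
    · exact Lp.coeFn_zero _ _ _
    · filter_upwards [Lp.coeFn_zero (GradVal d) 2 (volume.restrict Ω)] with x hx
      refine hx.trans ?_
      ext j
      simp [classicalGrad]
  | add p q _ _ hp hq =>
    obtain ⟨φ, hφ, hφc, hφs, hφ1, hφ2⟩ := hp
    obtain ⟨ψ, hψ, hψc, hψs, hψ1, hψ2⟩ := hq
    refine ⟨φ + ψ, hφ.add hψ, hφc.add hψc,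
      (tsupport_add φ ψ).trans (union_subset hφs hψs), ?_, ?_⟩
    · filter_upwards [Lp.coeFn_add p.fst q.fst, hφ1, hψ1] with x hx h1 h2
      rw [WithLp.add_fst, hx, Pi.add_apply, h1, h2, Pi.add_apply]
    · filter_upwards [Lp.coeFn_add p.snd q.snd, hφ2, hψ2] with x hx h1 h2
      rw [WithLp.add_snd, hx, Pi.add_apply, h1, h2]
      ext j
      simp [classicalGrad, fderiv_add (hφ.differentiable (by simp) x)
        (hψ.differentiable (by simp) x)]
  | smul c p _ hp =>
    obtain ⟨φ, hφ, hφc, hφs, hφ1, hφ2⟩ := hp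
    refine ⟨c • φ, contDiff_const.smul hφ, hφc.mono (Function.support_const_smul_subset c φ),
      (closure_mono (Function.support_const_smul_subset c φ)).trans hφs, ?_, ?_⟩
    · filter_upwards [Lp.coeFn_smul c p.fst, hφ1] with x hx h1
      rw [WithLp.smul_fst, hx, Pi.smul_apply, h1, Pi.smul_apply]
    · filter_upwards [Lp.coeFn_smul c p.snd, hφ2] with x hx h1
      rw [WithLp.smul_snd, hx, Pi.smul_apply, h1]
      ext j
      simp [classicalGrad, fderiv_const_smul (hφ.differentiable (by simp) x)]

/-- Multiplication of square integrable fields by a bounded function. -/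
def mulBounded {α : Type*} [MeasurableSpace α] {ν : Measure α} (F : Type*) [NormedAddCommGroup F]
    [NormedSpace ℝ F] (m : Lp ℝ ∞ ν) : Lp F 2 ν →L[ℝ] Lp F 2 ν :=
  (ContinuousLinearMap.lsmul ℝ ℝ).holderL ν ∞ 2 2 m

theorem coeFn_mulBounded {α : Type*} [MeasurableSpace α] {ν : Measure α} {F : Type*}
    [NormedAddCommGroup F] [NormedSpace ℝ F] {m : α → ℝ} (hm : MemLp m ∞ ν) (u : Lp F 2 ν) :
    mulBounded F hm.toLp u =ᵐ[ν] fun x => m x • u x := by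
  filter_upwards [ContinuousLinearMap.coeFn_holder (r := 2) (ContinuousLinearMap.lsmul ℝ ℝ)
    hm.toLp u, hm.coeFn_toLp] with x hx h1
  refine hx.trans ?_
  rw [h1]
  rfl

theorem integrable_mul_inner {α : Type*} [MeasurableSpace α] {ν : Measure α} {F : Type*}
    [NormedAddCommGroup F] [InnerProductSpace ℝ F] {m : α → ℝ} (hm : MemLp m ∞ ν)
    (u v : Lp F 2 ν) : Integrable (fun x => m x * inner ℝ (u x) (v x)) ν := by
  refine (L2.integrable_inner (𝕜 := ℝ) (mulBounded F hm.toLp u) v).congr ?_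
  filter_upwards [coeFn_mulBounded hm u] with x hx
  rw [hx, real_inner_smul_left]

theorem inner_mulBounded {α : Type*} [MeasurableSpace α] {ν : Measure α} {F : Type*}
    [NormedAddCommGroup F] [InnerProductSpace ℝ F] {m : α → ℝ} (hm : MemLp m ∞ ν)
    (u v : Lp F 2 ν) :
    inner ℝ (mulBounded F hm.toLp u) v = ∫ x, m x * inner ℝ (u x) (v x) ∂ν := by
  rw [L2.inner_def]
  refine integral_congr_ae ?_
  filter_upwards [coeFn_mulBounded hm u] with x hx
  rw [hx, real_inner_smul_left]

/-- The partial derivative `∂_j` as an operator on weak gradients. -/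
def partialL {d : ℕ} (Ω : Set (E d)) (j : Fin d) :
    Lp (GradVal d) 2 (volume.restrict Ω) →L[ℝ] Lp (E d) 2 (volume.restrict Ω) :=
  (PiLp.proj 2 (𝕜 := ℝ) (fun _ : Fin d => E d) j).compLpL 2 (volume.restrict Ω)

theorem coeFn_partialL {d : ℕ} {Ω : Set (E d)} (j : Fin d)
    (p : Lp (GradVal d) 2 (volume.restrict Ω)) :
    partialL Ω j p =ᵐ[volume.restrict Ω] fun x => p x j :=
  ContinuousLinearMap.coeFn_compLpL _ p

/-- Integration by parts for the energy density of a field in `H¹₀(Ω)^d` against a bounded locally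
Lipschitz coefficient with bounded derivative. -/
theorem integral_lineDeriv_H10 {d : ℕ} {Ω : Set (E d)} (hΩ : IsOpen Ω) {β β' : E d → ℝ}
    (hβ : LocallyLipschitzOn Ω β) {j : Fin d}
    (hβ' : ∀ᵐ x ∂(volume.restrict Ω),
      HasLineDerivAt ℝ β (β' x) x (EuclideanSpace.single j 1))
    (hm : MemLp β ∞ (volume.restrict Ω)) (hm' : MemLp β' ∞ (volume.restrict Ω)) (u : H10 Ω) :
    (∫ x in Ω, β' x * inner ℝ (toL2 u x) (toL2 u x))
      + 2 * ∫ x in Ω, β x * inner ℝ (toL2 u x) (partialL Ω j (wgrad u) x) = 0 := by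
  -- Writing both integrals through bounded operators on `L²` makes `Q` continuous, so its zero set
  -- is closed.
  let Q : L2Pair Ω → ℝ := fun p => inner ℝ (mulBounded (E d) hm'.toLp p.fst) p.fst
    + 2 * inner ℝ (mulBounded (E d) hm.toLp p.fst) (partialL Ω j p.snd)
  have hf : Continuous fun p : L2Pair Ω => p.fst := by fun_prop
  have hs : Continuous fun p : L2Pair Ω => p.snd := by fun_prop
  have hQ : Continuous Q := by
    refine ((((mulBounded (E d) hm'.toLp).continuous.comp hf).inner hf)).add
      (continuous_const.mul (((mulBounded (E d) hm.toLp).continuous.comp hf).inner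
        ((partialL Ω j).continuous.comp hs)))
  have hclosed : IsClosed {p | Q p = 0} := isClosed_eq hQ continuous_const
  have htest : testPairs Ω ⊆ {p | Q p = 0} := by
    rintro p ⟨φ, hφ, hc, hφs, h1, h2⟩
    have h := integral_lineDeriv_test hΩ hβ hβ' hφ hc hφs
    simp only [mem_ofPred_eq, Q, inner_mulBounded]
    rw [← integral_const_mul, ← integral_add (integrable_mul_inner hm' _ _)
      ((integrable_mul_inner hm _ _).const_mul _), ← h]
    refine integral_congr_ae ?_
    filter_upwards [h1, h2, coeFn_partialL j p.snd] with x h1 h2 h3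
    rw [h1, h3, h2, real_inner_self_eq_norm_sq]
    rfl
  have hmem : u.1 ∈ {p | Q p = 0} := by
    refine closure_minimal htest hclosed ?_
    rw [← span_testPairs]
    exact u.2
  simp only [mem_ofPred_eq, Q, inner_mulBounded] at hmem
  exact hmem

/-- Skew-symmetry of the convective term up to the divergence of the transporting field. -/
theorem integral_convection {d : ℕ} {Ω : Set (E d)} (hΩ : IsOpen Ω) {b : E d → E d}
    (hb : LocallyLipschitzOn Ω b) {K : ℝ} (hK : ∀ x ∈ Ω, ‖b x‖ ≤ K)
    (hD : ∀ᵐ x ∂(volume.restrict Ω), ‖fderiv ℝ b x‖ ≤ K) (u : H10 Ω) :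
    ∫ x in Ω, inner ℝ (convection b u x) (toL2 u x) =
      (1 / 2) * ∫ x in Ω, divergence b x * ‖toL2 u x‖ ^ 2 := by
  have hbm : AEStronglyMeasurable b (volume.restrict Ω) :=
    hb.continuousOn.aestronglyMeasurable hΩ.measurableSet
  have hm : ∀ j, MemLp (fun x => b x j) ∞ (volume.restrict Ω) := by
    intro j
    refine memLp_top_of_bound
      ((EuclideanSpace.proj (𝕜 := ℝ) j).continuous.comp_aestronglyMeasurable hbm) K ?_
    filter_upwards [ae_restrict_mem hΩ.measurableSet] with x hx
    exact (PiLp.norm_apply_le (b x) j).trans (hK x hx)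
  have hm' : ∀ j, MemLp (fun x => fderiv ℝ b x (EuclideanSpace.single j 1) j) ∞
      (volume.restrict Ω) := by
    intro j
    refine memLp_top_of_bound ?_ K ?_
    · exact ((EuclideanSpace.proj (𝕜 := ℝ) j).continuous.measurable.comp
        (measurable_fderiv_apply_const ℝ b _)).aestronglyMeasurable
    · filter_upwards [hD] with x hx
      refine (PiLp.norm_apply_le _ j).trans ((ContinuousLinearMap.le_opNorm _ _).trans ?_)
      simpa using hx
  have hdiff := ae_differentiableAt_of_locallyLipschitzOn (μ := volume) hΩ hb
  -- Taking `β = b_j` and summing over `j` yields `∫ (∇·b)|u|² = -2 ∫ ((b·∇)u)·u`.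
  have key : ∀ j, (∫ x in Ω, (fderiv ℝ b x (EuclideanSpace.single j 1) j)
        * inner ℝ (toL2 u x) (toL2 u x))
      + 2 * ∫ x in Ω, b x j * inner ℝ (toL2 u x) (partialL Ω j (wgrad u) x) = 0 := by
    intro j
    refine integral_lineDeriv_H10 hΩ (β := fun x => b x j) ?_ ?_ (hm j) (hm' j) u
    · exact (EuclideanSpace.proj (𝕜 := ℝ) j).contDiff.comp_locallyLipschitzOn hb
    · filter_upwards [hdiff] with x hx
      exact (((EuclideanSpace.proj (𝕜 := ℝ) j).hasFDerivAt (x := b x)).comp x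
        hx.hasFDerivAt).hasLineDerivAt _
  have e1 : ∫ x in Ω, divergence b x * ‖toL2 u x‖ ^ 2 =
      ∑ j, ∫ x in Ω, (fderiv ℝ b x (EuclideanSpace.single j 1) j)
        * inner ℝ (toL2 u x) (toL2 u x) := by
    rw [← integral_finsetSum _ fun j _ => integrable_mul_inner (hm' j) _ _]
    refine integral_congr_ae (Filter.Eventually.of_forall fun x => ?_)
    simp only [divergence, Finset.sum_mul, real_inner_self_eq_norm_sq]
  have e2 : ∫ x in Ω, inner ℝ (convection b u x) (toL2 u x) =
      (∑ j, ∫ x in Ω, (fderiv ℝ b x (EuclideanSpace.single j 1) j)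
        * inner ℝ (toL2 u x) (toL2 u x)) +
      ∑ j, ∫ x in Ω, b x j * inner ℝ (toL2 u x) (partialL Ω j (wgrad u) x) := by
    rw [← integral_finsetSum _ fun j _ => integrable_mul_inner (hm' j) _ _,
      ← integral_finsetSum _ fun j _ => integrable_mul_inner (hm j) _ _,
      ← integral_add (integrable_finsetSum _ fun j _ => integrable_mul_inner (hm' j) _ _)
        (integrable_finsetSum _ fun j _ => integrable_mul_inner (hm j) _ _)]
    refine integral_congr_ae ?_
    filter_upwards [ae_all_iff.2 fun j => coeFn_partialL j (wgrad u)] with x hx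
    simp only [convection, divergence, inner_add_left, real_inner_smul_left, Finset.sum_mul,
      sum_inner, hx]
    congr 1
    refine Finset.sum_congr rfl fun j _ => ?_
    rw [real_inner_comm]
  rw [e2, e1, Finset.mul_sum, ← Finset.sum_add_distrib]
  refine Finset.sum_congr rfl fun j _ => ?_
  linarith [key j]

/-! ### Sup norms, vanishing divergence, and the quantities in the time step restriction. -/

section LInfNorm

variable {d : ℕ} {F : Type*} [NormedAddCommGroup F] {Ω : Set (E d)} {g : E d → F}

theorem lInfNorm_nonneg : 0 ≤ lInfNorm Ω g := ENNReal.toReal_nonneg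

theorem lInfNorm_le {C : ℝ} (hC : 0 ≤ C) (h : ∀ᵐ x ∂(volume.restrict Ω), ‖g x‖ ≤ C) :
    lInfNorm Ω g ≤ C := by
  refine ENNReal.toReal_le_of_le_ofReal hC ?_
  rw [eLpNorm_exponent_top]
  exact eLpNormEssSup_le_of_ae_bound h

/-- Some finite bound `C` is needed first: for an essentially unbounded `g` the real-valued
`lInfNorm` would be 0. -/
theorem ae_norm_le_lInfNorm {C : ℝ} (h : ∀ᵐ x ∂(volume.restrict Ω), ‖g x‖ ≤ C) :
    ∀ᵐ x ∂(volume.restrict Ω), ‖g x‖ ≤ lInfNorm Ω g := by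
  have hfin : eLpNorm g ⊤ (volume.restrict Ω) ≠ ⊤ := by
    rw [eLpNorm_exponent_top]
    exact (eLpNormEssSup_lt_top_of_ae_bound h).ne
  filter_upwards [enorm_ae_le_eLpNormEssSup g (volume.restrict Ω)] with x hx
  rw [← eLpNorm_exponent_top] at hx
  rw [lInfNorm, ← toReal_enorm]
  exact ENNReal.toReal_mono hfin hx

end LInfNorm

theorem abs_divergence_le {d : ℕ} (b : E d → E d) (x : E d) :
    |divergence b x| ≤ d * ‖fderiv ℝ b x‖ := by
  refine (Finset.abs_sum_le_sum_abs _ _).trans ?_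
  have h : ∀ j ∈ (Finset.univ : Finset (Fin d)),
      |fderiv ℝ b x (EuclideanSpace.single j 1) j| ≤ ‖fderiv ℝ b x‖ := by
    intro j _
    refine (PiLp.norm_apply_le (fderiv ℝ b x (EuclideanSpace.single j 1)) j).trans
      ((ContinuousLinearMap.le_opNorm _ _).trans ?_)
    simp
  refine (Finset.sum_le_card_nsmul _ _ _ h).trans ?_
  simp

theorem measurable_divergence {d : ℕ} (b : E d → E d) : Measurable (divergence b) :=
  Finset.measurable_sum _ fun j _ => (EuclideanSpace.proj (𝕜 := ℝ) j).continuous.measurable.comp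
    (measurable_fderiv_apply_const ℝ b _)

/-- A bounded field whose divergence is orthogonal to all square integrable functions has almost
everywhere vanishing divergence. -/
theorem ae_divergence_eq_zero {d : ℕ} {Ω : Set (E d)} {b : E d → E d} {C : ℝ}
    (hC : ∀ᵐ x ∂(volume.restrict Ω), |divergence b x| ≤ C)
    (h : ∀ q : E d → ℝ, MemLp q 2 (volume.restrict Ω) → ∫ x in Ω, divergence b x * q x = 0) :
    ∀ᵐ x ∂(volume.restrict Ω), divergence b x = 0 := by
  have key : ∀ n : ℕ, ∀ᵐ x ∂(volume.restrict Ω), x ∈ Metric.ball (0 : E d) n →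
      divergence b x = 0 := by
    intro n
    set B := Metric.ball (0 : E d) n
    have hB : MeasurableSet B := Metric.isOpen_ball.measurableSet
    have hfin : (volume.restrict Ω).restrict B univ ≠ ⊤ := by
      rw [Measure.restrict_apply_univ]
      exact ((Measure.restrict_apply_le _ _).trans_lt measure_ball_lt_top).ne
    have : IsFiniteMeasure ((volume.restrict Ω).restrict B) := ⟨hfin.lt_top⟩
    -- The divergence itself is the test function, cut off to a ball since `Ω` may have infinite
    -- measure.
    have hq : MemLp (B.indicator (divergence b)) 2 (volume.restrict Ω) := by
      rw [memLp_indicator_iff_restrict hB]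
      exact MemLp.of_bound (measurable_divergence b).aestronglyMeasurable C
        (ae_restrict_of_ae hC)
    have h0 := h _ hq
    have hint := hq.integrable_sq
    have e : (fun x => divergence b x * B.indicator (divergence b) x) =
        fun x => B.indicator (divergence b) x ^ 2 := by
      funext x
      by_cases hx : x ∈ B <;> simp [hx, sq]
    rw [e, integral_eq_zero_iff_of_nonneg (fun x => sq_nonneg _) hint] at h0
    filter_upwards [h0] with x hx hxB
    simpa [hxB] using hx
  filter_upwards [ae_all_iff.2 key] with x hx
  obtain ⟨n, hn⟩ := exists_nat_gt ‖x‖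
  exact hx n (by simpa using hn)

namespace IsBiLipschitz

variable {d : ℕ} {Λ : ℝ≥0} {Ω : Set (E d)} {a : E d → E d}

theorem mapsTo_invFunOn : MapsTo (Function.invFunOn a Ω) (a '' Ω) Ω :=
  fun _ hx => Function.invFunOn_mem hx

theorem locallyLipschitzOn_comp_inv (h : IsBiLipschitz Λ Ω a) {v : E d → E d}
    (hv : LocallyLipschitzOn Ω v) :
    LocallyLipschitzOn (a '' Ω) fun x => v (Function.invFunOn a Ω x) :=
  LocallyLipschitzOn.comp' hv (h.bound_inv.locallyLipschitzOn h.isOpen_image) mapsTo_invFunOn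

theorem ae_norm_fderiv_comp_inv_le (h : IsBiLipschitz Λ Ω a) {v : E d → E d}
    (hv : LocallyLipschitzOn Ω v) {ℓ : ℝ} (hℓ : ∀ᵐ ξ ∂(volume.restrict Ω), ‖fderiv ℝ v ξ‖ ≤ ℓ) :
    ∀ᵐ x ∂(volume.restrict (a '' Ω)),
      ‖fderiv ℝ (fun y => v (Function.invFunOn a Ω y)) x‖ ≤ ℓ * Λ := by
  have hvd := ae_differentiableAt_of_locallyLipschitzOn (μ := volume) h.isOpen hv
  filter_upwards [h.ae_image (h.ae_differentiableAt.and (hvd.and hℓ))] with x hx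
  obtain ⟨ξ, hξ, rfl, hda, hdv, hb⟩ := hx
  obtain ⟨e, -, hes, he⟩ := h.exists_fderiv_eq hξ hda
  have hdv' : HasFDerivAt v (fderiv ℝ v ξ) (Function.invFunOn a Ω (a ξ)) := by
    rw [h.invFunOn_apply hξ]
    exact hdv.hasFDerivAt
  have hcomp := (hdv'.comp (a ξ) he).fderiv
  change fderiv ℝ (v ∘ Function.invFunOn a Ω) (a ξ) = _ at hcomp
  change ‖fderiv ℝ (v ∘ Function.invFunOn a Ω) (a ξ)‖ ≤ _
  rw [hcomp]
  have : 0 ≤ ℓ := (norm_nonneg _).trans hb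
  exact (ContinuousLinearMap.opNorm_comp_le _ _).trans (by gcongr)

/-- The gradient of a bi-Lipschitz map is bounded below, unless the domain is trivial. -/
theorem one_le_mul_lInfNorm_fderiv (h : IsBiLipschitz Λ Ω a) (hd : d ≠ 0)
    (hΩ : (volume.restrict Ω : Measure (E d)) ≠ 0) : 1 ≤ Λ * lInfNorm Ω (fderiv ℝ a) := by
  have hb : ∀ᵐ ξ ∂(volume.restrict Ω), ‖fderiv ℝ a ξ‖ ≤ Λ := by
    filter_upwards [ae_restrict_mem h.isOpen.measurableSet] with ξ hξ
    exact h.bound.norm_fderiv_le h.isOpen hξ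
  have : (ae (volume.restrict Ω : Measure (E d))).NeBot := ae_neBot.2 hΩ
  obtain ⟨ξ, ⟨hξ1, hξ2⟩, hξ⟩ := ((h.ae_differentiableAt.and (ae_norm_le_lInfNorm hb)).and
    (ae_restrict_mem h.isOpen.measurableSet)).exists
  obtain ⟨e, he, hes, -⟩ := h.exists_fderiv_eq hξ hξ1
  have : NeZero d := ⟨hd⟩
  have hid : ContinuousLinearMap.id ℝ (E d) = (e.symm : E d →L[ℝ] E d) ∘L fderiv ℝ a ξ := by
    ext1 v
    simp [he]
  calc (1 : ℝ) = ‖ContinuousLinearMap.id ℝ (E d)‖ := ContinuousLinearMap.norm_id.symm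
    _ ≤ ‖(e.symm : E d →L[ℝ] E d)‖ * ‖fderiv ℝ a ξ‖ := by
      rw [hid]; exact ContinuousLinearMap.opNorm_comp_le _ _
    _ ≤ _ := by gcongr

/-- Control of the divergence of a transported field by the gradients that appear in the time
step restriction. -/
theorem sq_lInfNorm_divergence_le (h : IsBiLipschitz Λ Ω a) {v : E d → E d}
    (hv : LocallyLipschitzOn Ω v)
    (hℓ : ∀ᵐ ξ ∂(volume.restrict Ω), ‖fderiv ℝ v ξ‖ ≤ lInfNorm Ω (fderiv ℝ v)) :
    lInfNorm (a '' Ω) (divergence fun y => v (Function.invFunOn a Ω y)) ^ 2 ≤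
      d * Λ ^ 2 * (lInfNorm Ω (fderiv ℝ v) * lInfNorm Ω (fderiv ℝ a) *
        lInfNorm (a '' Ω) (divergence fun y => v (Function.invFunOn a Ω y))) := by
  set D := lInfNorm (a '' Ω) (divergence fun y => v (Function.invFunOn a Ω y)) with hD
  set ℓ := lInfNorm Ω (fderiv ℝ v)
  have hℓ0 : 0 ≤ ℓ := lInfNorm_nonneg
  have hD0 : 0 ≤ D := lInfNorm_nonneg
  have hDle : D ≤ d * (ℓ * Λ) := by
    refine lInfNorm_le (by positivity) ?_
    filter_upwards [h.ae_norm_fderiv_comp_inv_le hv hℓ] with x hx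
    exact (abs_divergence_le _ x).trans (by gcongr)
  -- In dimension 0 and on a null domain `1 ≤ Λ‖Da‖` may fail, but then `D = 0`.
  by_cases hd : d = 0
  · have : D = 0 := le_antisymm (by simpa [hd] using hDle) hD0
    simp [this]
  by_cases hΩ : (volume.restrict Ω : Measure (E d)) = 0
  · have : D = 0 := by
      refine le_antisymm (lInfNorm_le le_rfl ?_) hD0
      have h1 : ∀ᵐ ξ ∂(volume.restrict Ω : Measure (E d)), False := by simp [hΩ]
      filter_upwards [h.ae_image h1] with x hx
      obtain ⟨_, _, _, hf⟩ := hx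
      exact hf.elim
    simp [this]
  have h1 := h.one_le_mul_lInfNorm_fderiv hd hΩ
  calc D ^ 2 = D * 1 * D := by ring
    _ ≤ (d * (ℓ * Λ)) * (Λ * lInfNorm Ω (fderiv ℝ a)) * D := by gcongr
    _ = _ := by ring

end IsBiLipschitz

/-! ### Scalar inequalities: Young, one energy step, Gronwall. -/

theorem norm_sq_eq_integral {α F : Type*} [MeasurableSpace α] {ν : Measure α}
    [NormedAddCommGroup F] [InnerProductSpace ℝ F] (u : Lp F 2 ν) :
    ‖u‖ ^ 2 = ∫ x, ‖u x‖ ^ 2 ∂ν := by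
  rw [← real_inner_self_eq_norm_sq, L2.inner_def]
  exact integral_congr_ae (Filter.Eventually.of_forall fun x => real_inner_self_eq_norm_sq _)

/-- Young's inequality for the old mass term, tested with a transported function. -/
theorem abs_integral_inner_le {α F : Type*} [MeasurableSpace α] {ν : Measure α}
    [NormedAddCommGroup F] [InnerProductSpace ℝ F] {u v : α → F} (hu : MemLp u 2 ν) {B : ℝ}
    (hB : 0 ≤ B) (hv : ∫⁻ x, ENNReal.ofReal (‖v x‖ ^ 2) ∂ν ≤ ENNReal.ofReal B) {θ : ℝ}
    (hθ : 0 < θ) :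
    |∫ x, inner ℝ (u x) (v x) ∂ν| ≤ (1 / 2) * (θ * ∫ x, ‖u x‖ ^ 2 ∂ν) + (1 / 2) * (θ⁻¹ * B) := by
  have hu2 : Integrable (fun x => ‖u x‖ ^ 2) ν := hu.integrable_norm_pow (by norm_num)
  have hpt : ∀ x, |inner ℝ (u x) (v x)| ≤ θ / 2 * ‖u x‖ ^ 2 + θ⁻¹ / 2 * ‖v x‖ ^ 2 := by
    intro x
    refine (abs_real_inner_le_norm _ _).trans ?_
    have h := mul_nonneg (inv_nonneg.2 hθ.le) (sq_nonneg (θ * ‖u x‖ - ‖v x‖))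
    have e : θ⁻¹ * (θ * ‖u x‖ - ‖v x‖) ^ 2 =
        θ * ‖u x‖ ^ 2 + θ⁻¹ * ‖v x‖ ^ 2 - 2 * (‖u x‖ * ‖v x‖) := by
      field_simp
      ring
    linarith
  have hI : 0 ≤ ∫ x, ‖u x‖ ^ 2 ∂ν := integral_nonneg fun x => sq_nonneg _
  -- Passing to lower integrals avoids any measurability requirement on `v`.
  refine (norm_integral_le_lintegral_norm (fun x => inner ℝ (u x) (v x))).trans ?_
  refine ENNReal.toReal_le_of_le_ofReal (by positivity) ?_
  calc ∫⁻ x, ENNReal.ofReal ‖inner ℝ (u x) (v x)‖ ∂ν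
      ≤ ∫⁻ x, (ENNReal.ofReal (θ / 2 * ‖u x‖ ^ 2) +
          ENNReal.ofReal (θ⁻¹ / 2) * ENNReal.ofReal (‖v x‖ ^ 2)) ∂ν := by
        refine lintegral_mono fun x => ?_
        rw [← ENNReal.ofReal_mul (by positivity), ← ENNReal.ofReal_add (by positivity)
          (by positivity)]
        exact ENNReal.ofReal_le_ofReal (hpt x)
    _ = ENNReal.ofReal (∫ x, θ / 2 * ‖u x‖ ^ 2 ∂ν) +
          ENNReal.ofReal (θ⁻¹ / 2) * ∫⁻ x, ENNReal.ofReal (‖v x‖ ^ 2) ∂ν := by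
        rw [lintegral_add_left' (hu2.const_mul _).1.aemeasurable.ennreal_ofReal,
          lintegral_const_mul' _ _ ENNReal.ofReal_ne_top,
          ofReal_integral_eq_lintegral_ofReal (hu2.const_mul _)
            (Filter.Eventually.of_forall fun x => by positivity)]
    _ ≤ ENNReal.ofReal (∫ x, θ / 2 * ‖u x‖ ^ 2 ∂ν) +
          ENNReal.ofReal (θ⁻¹ / 2) * ENNReal.ofReal B := by gcongr
    _ = _ := by
        rw [← ENNReal.ofReal_mul (by positivity), integral_const_mul,
          ← ENNReal.ofReal_add (by positivity) (by positivity)]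
        congr 1
        ring

/-- The scalar inequality behind one step of the energy estimate. For short steps the old energy
enters with a factor close to one; for long steps a fixed factor `4 M` is affordable. -/
theorem energy_step {a a₀ g gs φ P I F Δt T μ μT m M c₁ c₂ ε : ℝ}
    (ha : 0 ≤ a) (ha₀ : 0 ≤ a₀) (hg : 0 ≤ g) (hgs : 0 ≤ gs)
    (hΔt : 0 < Δt) (hT : Δt ≤ T) (hμT : 0 ≤ μT)
    (heq : a - P + 2 * μ * Δt * g + μT * Δt * gs - Δt / 2 * I = Δt * F)
    (hP : ∀ θ : ℝ, 0 < θ → |P| ≤ (1 / 2) * (θ * a₀) + (1 / 2) * (θ⁻¹ * (m * a)))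
    (hm : m ≤ 1 + c₁ * Δt) (hmM : m ≤ M) (hM : 1 ≤ M) (hc₁ : 0 ≤ c₁) (hc₂ : 0 ≤ c₂)
    (hI : |I| ≤ c₂ * a) (hI' : Δt * |I| ≤ a / 2)
    (hε : 0 < ε) (hεμ : ε ≤ 2 * μ) (hεT : ε * T ≤ 1 / 4)
    (hF : F ≤ φ ^ 2 / (2 * ε) + ε / 2 * (a + g)) :
    a + 2 * μ * Δt * g + μT * Δt * gs ≤
      Real.exp (2 * (c₁ + c₂ + ε) * (1 + Real.log (4 * M)) * Δt) *
        (a₀ + Δt * (φ ^ 2 / ε)) := by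
  set η := c₁ + c₂ + ε with hη
  have hη0 : 0 < η := by positivity
  have hlog : 0 ≤ Real.log (4 * M) := Real.log_nonneg (by linarith)
  set Y := a₀ + Δt * (φ ^ 2 / ε) with hY
  have hf0 : 0 ≤ Δt * (φ ^ 2 / ε) := by positivity
  have hY0 : 0 ≤ Y := by positivity
  have hI1 : Δt * I ≤ Δt * (c₂ * a) := by gcongr; exact (le_abs_self I).trans hI
  have hI2 : Δt * I ≤ a / 2 := (by gcongr; exact le_abs_self I : Δt * I ≤ Δt * |I|).trans hI'
  have hF1 : 2 * (Δt * F) ≤ Δt * (φ ^ 2 / ε) + Δt * ε * (a + g) := by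
    have : Δt * F ≤ Δt * (φ ^ 2 / (2 * ε) + ε / 2 * (a + g)) := by gcongr
    have e : 2 * (Δt * (φ ^ 2 / (2 * ε) + ε / 2 * (a + g))) =
        Δt * (φ ^ 2 / ε) + Δt * ε * (a + g) := by field_simp
    linarith
  have hεg : Δt * ε * g ≤ 2 * μ * Δt * g := by
    have : ε * (Δt * g) ≤ 2 * μ * (Δt * g) := by gcongr
    linarith
  have hgs' : 0 ≤ μT * Δt * gs := by positivity
  have hg' : 0 ≤ 2 * μ * Δt * g := by
    have : 0 < 2 * μ := hε.trans_le hεμ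
    positivity
  set X := a + 2 * μ * Δt * g + μT * Δt * gs with hX
  have hX0 : 0 ≤ X := by positivity
  -- Short steps: Young with weight 1, then `(1 + 2x)(1 - x) ≥ 1` for `0 ≤ x ≤ 1/2`.
  rcases le_total (η * Δt) (1 / 2) with hs | hl
  · have hP1 := (le_abs_self P).trans (hP 1 one_pos)
    have hm1 : m * a ≤ (1 + c₁ * Δt) * a := by gcongr
    have h1 : (1 - η * Δt) * X ≤ Y := by
      have h2 : (1 - η * Δt) * X ≤ (1 - η * Δt) * a + (2 * μ * Δt * g + μT * Δt * gs) := by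
        have : 0 ≤ η * Δt * (2 * μ * Δt * g + μT * Δt * gs) := by positivity
        rw [hX]
        linarith
      rw [inv_one] at hP1
      have e : (1 - η * Δt) * a = a - c₁ * Δt * a - Δt * (c₂ * a) - Δt * ε * a := by
        rw [hη]; ring
      rw [hY]
      linarith
    have h3 : X ≤ (1 + 2 * η * Δt) * Y := by
      have hx : 0 ≤ η * Δt := by positivity
      have h4 : 1 * X ≤ ((1 + 2 * η * Δt) * (1 - η * Δt)) * X := by
        gcongr
        nlinarith
      calc X ≤ ((1 + 2 * η * Δt) * (1 - η * Δt)) * X := by linarith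
        _ = (1 + 2 * η * Δt) * ((1 - η * Δt) * X) := by ring
        _ ≤ _ := by gcongr
    refine h3.trans ?_
    gcongr
    have h5 := Real.add_one_le_exp (2 * η * Δt)
    refine (by linarith : 1 + 2 * η * Δt ≤ Real.exp (2 * η * Δt)).trans ?_
    have : 0 ≤ 2 * η * Real.log (4 * M) * Δt := by positivity
    exact Real.exp_le_exp.2 (by linarith)
  -- Long steps: with weight `4 M` the absorbed parts of `2a` are `a/4` (mass), `a/2` (divergence)
  -- and `a/4` (force), leaving exactly `a`.
  · have hM0 : 0 < M := by linarith
    have hP1 := (le_abs_self P).trans (hP (4 * M) (by positivity))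
    have hm1 : (4 * M)⁻¹ * (m * a) ≤ a / 4 := by
      have : (4 * M)⁻¹ * (m * a) ≤ (4 * M)⁻¹ * (M * a) := by gcongr
      have e : (4 * M)⁻¹ * (M * a) = a / 4 := by field_simp
      linarith
    have hεa : Δt * ε * a ≤ 1 / 4 * a := by
      gcongr
      calc Δt * ε ≤ T * ε := by gcongr
        _ ≤ 1 / 4 := by linarith
    have h1 : X ≤ 4 * M * Y := by
      have : Δt * (φ ^ 2 / ε) ≤ 4 * M * (Δt * (φ ^ 2 / ε)) :=
        le_mul_of_one_le_left hf0 (by linarith)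
      rw [hY, hX]
      linarith
    refine h1.trans ?_
    gcongr
    rw [← Real.log_le_iff_le_exp (by positivity)]
    -- Since `2 η Δt ≥ 1`, the fixed factor `4 M` fits under the exponential.
    have h6 : 1 * Real.log (4 * M) ≤ (2 * (η * Δt)) * (1 + Real.log (4 * M)) := by
      gcongr <;> linarith
    linarith

/-- Discrete Gronwall inequality. -/
theorem discrete_gronwall {a D F : ℕ → ℝ} {R : ℝ} {N : ℕ} (hR : 1 ≤ R) (hD : ∀ n, 0 ≤ D n)
    (hF : ∀ n, 0 ≤ F n) (h : ∀ n < N, a (n + 1) + D n ≤ R * (a n + F n)) :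
    ∀ n ≤ N, a n + ∑ i ∈ Finset.range n, D i ≤ R ^ n * (a 0 + ∑ i ∈ Finset.range n, F i) := by
  intro n
  induction n with
  | zero => simp
  | succ n ih =>
    intro hn
    have h1 := ih (by omega)
    have h2 := h n (by omega)
    have hs : 0 ≤ ∑ i ∈ Finset.range n, D i := Finset.sum_nonneg fun i _ => hD i
    rw [Finset.sum_range_succ, Finset.sum_range_succ]
    have hRn : 1 ≤ R ^ n := one_le_pow₀ hR
    -- The dissipation already collected may be multiplied by `R ≥ 1`.
    calc a (n + 1) + (∑ i ∈ Finset.range n, D i + D n)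
        ≤ R * (a n + F n) + R * ∑ i ∈ Finset.range n, D i := by nlinarith
      _ = R * (a n + ∑ i ∈ Finset.range n, D i) + R * F n := by ring
      _ ≤ R * (R ^ n * (a 0 + ∑ i ∈ Finset.range n, F i)) + R * (R ^ n * F n) := by
        gcongr
        exact le_mul_of_one_le_left (hF n) hRn
      _ = _ := by ring

/-! ### The energy estimate for one time step. -/

theorem IsALEMap.isBiLipschitz {d : ℕ} {Ω₀ : Set (E d)} {T : ℝ} {Λ : ℝ≥0} {A : ℝ → E d → E d}
    (hA : IsALEMap Ω₀ T Λ A) {t : ℝ} (ht : t ∈ Icc 0 T) : IsBiLipschitz Λ Ω₀ (A t) :=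
  ⟨hA.isOpen_ref, hA.injOn t ht, hA.isOpen_image t ht, hA.w1inf t ht, hA.w1inf_inv t ht⟩

theorem norm_sq_H10 {d : ℕ} {Ω : Set (E d)} (u : H10 Ω) :
    ‖u‖ ^ 2 = ‖toL2 u‖ ^ 2 + ‖wgrad u‖ ^ 2 :=
  WithLp.prod_norm_sq_eq_of_L2 u.1

/-- The dual of the full `H¹` norm produces a mass term besides the gradient; `ε` must be small
enough for both to be absorbed. -/
theorem apply_le_young {d : ℕ} {Ω : Set (E d)} (f : HMinus1 Ω) (u : H10 Ω) {ε : ℝ} (hε : 0 < ε) :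
    f u ≤ ‖f‖ ^ 2 / (2 * ε) + ε / 2 * (‖toL2 u‖ ^ 2 + ‖wgrad u‖ ^ 2) := by
  rw [← norm_sq_H10]
  refine (le_abs_self _).trans ((f.le_opNorm u).trans ?_)
  have h := mul_nonneg (inv_nonneg.2 hε.le) (sq_nonneg (‖f‖ - ε * ‖u‖))
  have e : ε⁻¹ * (‖f‖ - ε * ‖u‖) ^ 2 =
      2 * (‖f‖ ^ 2 / (2 * ε) + ε / 2 * ‖u‖ ^ 2 - ‖f‖ * ‖u‖) := by
    field_simp
    ring
  linarith

section Step

variable {d : ℕ} {Λ : ℝ≥0} {Ω₀ : Set (E d)} {A : ℝ → E d → E d} {Δt : ℝ} {n : ℕ}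

theorem locallyLipschitzOn_refMeshVel (ha : IsBiLipschitz Λ Ω₀ (A (node Δt n)))
    (hb : IsBiLipschitz Λ Ω₀ (A (node Δt (n + 1)))) :
    LocallyLipschitzOn Ω₀ (refMeshVel A Δt n) := by
  have h : ContDiff ℝ 1 fun v : E d => Δt⁻¹ • v := contDiff_const_smul _
  exact h.comp_locallyLipschitzOn (hb.locallyLipschitzOn.sub ha.locallyLipschitzOn)

theorem norm_refMeshVel_le (ha : IsBiLipschitz Λ Ω₀ (A (node Δt n)))
    (hb : IsBiLipschitz Λ Ω₀ (A (node Δt (n + 1)))) (hΔt : 0 < Δt) {ξ : E d} (hξ : ξ ∈ Ω₀) :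
    ‖refMeshVel A Δt n ξ‖ ≤ 2 * Λ / Δt := by
  rw [refMeshVel, norm_smul, norm_inv, Real.norm_of_nonneg hΔt.le, inv_mul_eq_div]
  gcongr
  refine (norm_sub_le _ _).trans ?_
  linarith [ha.bound.1 ξ hξ, hb.bound.1 ξ hξ]

theorem ae_fderiv_refMeshVel (ha : IsBiLipschitz Λ Ω₀ (A (node Δt n)))
    (hb : IsBiLipschitz Λ Ω₀ (A (node Δt (n + 1)))) (hΔt : 0 < Δt) :
    ∀ᵐ ξ ∂(volume.restrict Ω₀),
      fderiv ℝ (fun η => A (node Δt (n + 1)) η - A (node Δt n) η) ξ =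
          Δt • fderiv ℝ (refMeshVel A Δt n) ξ ∧
        ‖fderiv ℝ (refMeshVel A Δt n) ξ‖ ≤ 2 * Λ / Δt := by
  filter_upwards [ha.ae_differentiableAt, hb.ae_differentiableAt,
    ae_restrict_mem ha.isOpen.measurableSet] with ξ hda hdb hξ
  have h : fderiv ℝ (refMeshVel A Δt n) ξ =
      Δt⁻¹ • fderiv ℝ (fun η => A (node Δt (n + 1)) η - A (node Δt n) η) ξ :=
    fderiv_fun_const_smul (hdb.fun_sub hda) _
  refine ⟨by rw [h, smul_inv_smul₀ hΔt.ne'], ?_⟩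
  rw [h, norm_smul, norm_inv, Real.norm_of_nonneg hΔt.le, inv_mul_eq_div,
    fderiv_fun_sub hdb hda]
  gcongr
  refine (norm_sub_le _ _).trans ?_
  linarith [ha.bound.norm_fderiv_le ha.isOpen hξ, hb.bound.norm_fderiv_le ha.isOpen hξ]

set_option maxHeartbeats 800000 in
/-- The energy estimate for one step of the backward Euler scheme, tested with the solution. -/
theorem backwardEuler_energy_step (ha : IsBiLipschitz Λ Ω₀ (A (node Δt n)))
    (hb : IsBiLipschitz Λ Ω₀ (A (node Δt (n + 1)))) {T c L μ μT ε : ℝ} (hc0 : 0 ≤ c)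
    (hc : ∀ B : E d →L[ℝ] E d, ‖B‖ ≤ 2 * Λ * Λ →
      |(ContinuousLinearMap.id ℝ (E d) - B).det| ≤ 1 + c * ‖B‖)
    (hΔt : 0 < Δt) (hT : Δt ≤ T) (hμT : 0 ≤ μT)
    (hε : 0 < ε) (hεμ : ε ≤ 2 * μ) (hεT : ε * T ≤ 1 / 4)
    (hL : lInfNorm Ω₀ (fderiv ℝ (refMeshVel A Δt n)) ≤ L)
    (hdiv : Δt * lInfNorm (dom Ω₀ A Δt (n + 1)) (divergence (meshVel Ω₀ A Δt n)) ≤ 1 / 2)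
    {us : E d → E d} {K : ℝ≥0} (hus : W1InfBound K (dom Ω₀ A Δt (n + 1)) us)
    (hus' : ∀ q : E d → ℝ, MemLp q 2 (volume.restrict (dom Ω₀ A Δt (n + 1))) →
      ∫ x in dom Ω₀ A Δt (n + 1), divergence us x * q x = 0)
    (f : HMinus1 (dom Ω₀ A Δt (n + 1))) (u uS : H10 (dom Ω₀ A Δt (n + 1)))
    {u' : E d → E d} (hu' : MemLp u' 2 (volume.restrict (dom Ω₀ A Δt n)))
    (heq : (∫ x in dom Ω₀ A Δt (n + 1), inner ℝ (toL2 u x) (toL2 u x))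
      - (∫ x in dom Ω₀ A Δt n, inner ℝ (u' x) (transportBack Ω₀ A Δt n (toL2 u) x))
      + 2 * μ * Δt * (∫ x in dom Ω₀ A Δt (n + 1), inner ℝ (wgrad u x) (wgrad u x))
      + μT * Δt * (∫ x in dom Ω₀ A Δt (n + 1), inner ℝ (wgrad uS x) (wgrad uS x))
      + Δt * (∫ x in dom Ω₀ A Δt (n + 1),
          inner ℝ (convection (fun y => us y - meshVel Ω₀ A Δt n y) u x) (toL2 u x))
      = Δt * f u) :
    ‖toL2 u‖ ^ 2 + 2 * μ * Δt * ‖wgrad u‖ ^ 2 + μT * Δt * ‖wgrad uS‖ ^ 2 ≤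
      Real.exp (2 * (c * (Λ * L) + d * (Λ * L) + ε) *
          (1 + Real.log (4 * (1 + c * (2 * Λ * Λ)))) * Δt) *
        ((∫ x in dom Ω₀ A Δt n, ‖u' x‖ ^ 2) + Δt * (‖f‖ ^ 2 / ε)) := by
  set ν := (volume.restrict (dom Ω₀ A Δt (n + 1)) : Measure (E d)) with hν
  set w := meshVel Ω₀ A Δt n with hw
  have hΩ : IsOpen (dom Ω₀ A Δt (n + 1)) := hb.isOpen_image
  set ℓ := lInfNorm Ω₀ (fderiv ℝ (refMeshVel A Δt n)) with hℓdef
  have hℓ0 : 0 ≤ ℓ := lInfNorm_nonneg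
  have hL0 : 0 ≤ L := hℓ0.trans hL
  have hae := ae_fderiv_refMeshVel ha hb hΔt
  have hae2 := hae.mono fun ξ h => h.2
  have hℓ := ae_norm_le_lInfNorm hae2
  -- This bound uses only `Λ`, not `L`: it keeps `B` in a fixed ball and the Jacobian factor below
  -- `M` however long the step.
  have hℓΛ : Δt * ℓ ≤ 2 * Λ := by
    have h : ℓ ≤ 2 * Λ / Δt := lInfNorm_le (by positivity) hae2
    rwa [le_div_iff₀ hΔt, mul_comm] at h
  have hvl := locallyLipschitzOn_refMeshVel ha hb
  have hwl : LocallyLipschitzOn (dom Ω₀ A Δt (n + 1)) w := hb.locallyLipschitzOn_comp_inv hvl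
  have hwD : ∀ᵐ x ∂ν, ‖fderiv ℝ w x‖ ≤ ℓ * Λ := hb.ae_norm_fderiv_comp_inv_le hvl hℓ
  have hdivw : ∀ᵐ x ∂ν, |divergence w x| ≤ d * (Λ * L) := by
    filter_upwards [hwD] with x hx
    refine (abs_divergence_le w x).trans ?_
    gcongr
    rw [mul_comm]
    exact hx.trans (by gcongr)
  have hdivw' : ∀ᵐ x ∂ν, |divergence w x| ≤ lInfNorm (dom Ω₀ A Δt (n + 1)) (divergence w) :=
    ae_norm_le_lInfNorm (g := divergence w) hdivw
  have husl := hus.locallyLipschitzOn hΩ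
  have husD : ∀ᵐ x ∂ν, ‖fderiv ℝ us x‖ ≤ K := by
    filter_upwards [ae_restrict_mem hΩ.measurableSet] with x hx
    exact hus.norm_fderiv_le hΩ hx
  have hdivus : ∀ᵐ x ∂ν, divergence us x = 0 := by
    refine ae_divergence_eq_zero (C := d * K) ?_ hus'
    filter_upwards [husD] with x hx
    exact (abs_divergence_le us x).trans (by gcongr)
  have hdus := ae_differentiableAt_of_locallyLipschitzOn (μ := volume) hΩ husl
  have hdw := ae_differentiableAt_of_locallyLipschitzOn (μ := volume) hΩ hwl
  have hu2 : Integrable (fun x => ‖toL2 u x‖ ^ 2) ν :=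
    (Lp.memLp (toL2 u)).integrable_norm_pow (by norm_num)
  have hconv : ∫ x in dom Ω₀ A Δt (n + 1),
      inner ℝ (convection (fun y => us y - w y) u x) (toL2 u x) =
      -(1 / 2) * ∫ x in dom Ω₀ A Δt (n + 1), divergence w x * ‖toL2 u x‖ ^ 2 := by
    have hbl : LocallyLipschitzOn (dom Ω₀ A Δt (n + 1)) fun y => us y - w y := husl.sub hwl
    -- The bound `K` degenerates as `Δt → 0`, but it only secures integrability and does not enter
    -- the estimate.
    rw [integral_convection hΩ hbl (K := K + (2 * Λ / Δt + ℓ * Λ)) ?_ ?_ u, neg_mul,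
      ← mul_neg, ← integral_neg]
    · congr 1
      refine integral_congr_ae ?_
      filter_upwards [hdus, hdw, hdivus] with x h1 h2 h3
      have : divergence (fun y => us y - w y) x = divergence us x - divergence w x := by
        simp [divergence, fderiv_fun_sub h1 h2]
      rw [this, h3]
      ring
    · intro x hx
      have h1 := hus.1 x hx
      have h2 : ‖w x‖ ≤ 2 * Λ / Δt :=
        norm_refMeshVel_le ha hb hΔt (IsBiLipschitz.mapsTo_invFunOn hx)
      have h3 : 0 ≤ ℓ * Λ := by positivity
      exact (norm_sub_le _ _).trans (by linarith)
    · filter_upwards [hdus, hdw, husD, hwD] with x h1 h2 h3 h4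
      rw [fderiv_fun_sub h1 h2]
      have h5 : 0 ≤ 2 * Λ / Δt := by positivity
      exact (norm_sub_le _ _).trans (by linarith)
  have hIbound : ∀ C : ℝ, (∀ᵐ x ∂ν, |divergence w x| ≤ C) →
      |∫ x, divergence w x * ‖toL2 u x‖ ^ 2 ∂ν| ≤ C * ‖toL2 u‖ ^ 2 := by
    intro C hC
    rw [norm_sq_eq_integral, ← integral_const_mul, ← Real.norm_eq_abs]
    refine norm_integral_le_of_norm_le (hu2.const_mul C) ?_
    filter_upwards [hC] with x hx
    rw [norm_mul, Real.norm_eq_abs, Real.norm_of_nonneg (sq_nonneg _)]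
    gcongr
  have hself : ∀ {F : Type} [NormedAddCommGroup F] [InnerProductSpace ℝ F] (v : Lp F 2 ν),
      ∫ x in dom Ω₀ A Δt (n + 1), inner ℝ (v x) (v x) = ‖v‖ ^ 2 := by
    intro F _ _ v
    rw [norm_sq_eq_integral]
    exact integral_congr_ae (Filter.Eventually.of_forall fun x => real_inner_self_eq_norm_sq _)
  rw [hconv, hself, hself, hself] at heq
  have htr : ∫⁻ x in dom Ω₀ A Δt n,
      ENNReal.ofReal (‖transportBack Ω₀ A Δt n (toL2 u) x‖ ^ 2) ≤
      ENNReal.ofReal ((1 + c * (Δt * ℓ * Λ)) * ‖toL2 u‖ ^ 2) := by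
    have h := lintegral_transport_le hc hc0 ha hb (δ := Δt * ℓ) ?_ (by gcongr)
      (fun x => ENNReal.ofReal (‖toL2 u x‖ ^ 2))
    · refine h.trans_eq ?_
      rw [ENNReal.ofReal_mul (by positivity), norm_sq_eq_integral,
        ofReal_integral_eq_lintegral_ofReal hu2
          (Filter.Eventually.of_forall fun x => sq_nonneg _)]
    · filter_upwards [hae, hℓ] with ξ h1 h2
      rw [h1.1, norm_smul, Real.norm_of_nonneg hΔt.le]
      gcongr
  refine energy_step (P := ∫ x in dom Ω₀ A Δt n,
      inner ℝ (u' x) (transportBack Ω₀ A Δt n (toL2 u) x))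
    (I := ∫ x, divergence w x * ‖toL2 u x‖ ^ 2 ∂ν) (F := f u)
    (m := 1 + c * (Δt * ℓ * Λ)) (sq_nonneg _) (integral_nonneg fun x => sq_nonneg _)
    (sq_nonneg _) (sq_nonneg _) hΔt hT hμT (by rw [← heq]; ring)
    (fun θ hθ => abs_integral_inner_le hu' (by positivity) htr hθ) ?_ ?_ ?_ (by positivity)
    (by positivity) (hIbound _ hdivw) ?_ hε hεμ hεT (apply_le_young f u hε)
  · have : c * (Δt * ℓ * Λ) ≤ c * (Δt * L * Λ) := by gcongr
    linarith
  · gcongr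
  · have : 0 ≤ c * (2 * Λ * Λ) := by positivity
    linarith
  · have h1 := hIbound _ hdivw'
    calc Δt * _ ≤ Δt * (lInfNorm (dom Ω₀ A Δt (n + 1)) (divergence w) * ‖toL2 u‖ ^ 2) := by gcongr
      _ = (Δt * lInfNorm (dom Ω₀ A Δt (n + 1)) (divergence w)) * ‖toL2 u‖ ^ 2 := by ring
      _ ≤ 1 / 2 * ‖toL2 u‖ ^ 2 := by gcongr
      _ = _ := by ring

/-- The time step restriction bounds the divergence of the mesh velocity over one step. -/
theorem mul_lInfNorm_divergence_meshVel_le (ha : IsBiLipschitz Λ Ω₀ (A (node Δt n)))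
    (hb : IsBiLipschitz Λ Ω₀ (A (node Δt (n + 1)))) (hΔt : 0 < Δt)
    (h : (2 * d * Λ ^ 2 + 1 : ℝ) * Δt ^ 2 * lInfNorm Ω₀ (fderiv ℝ (refMeshVel A Δt n))
      * lInfNorm Ω₀ (fderiv ℝ (A (node Δt (n + 1))))
      * lInfNorm (dom Ω₀ A Δt (n + 1)) (divergence (meshVel Ω₀ A Δt n)) ≤ 1 / 2) :
    Δt * lInfNorm (dom Ω₀ A Δt (n + 1)) (divergence (meshVel Ω₀ A Δt n)) ≤ 1 / 2 := by
  have hsq := hb.sq_lInfNorm_divergence_le (locallyLipschitzOn_refMeshVel ha hb)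
    (ae_norm_le_lInfNorm ((ae_fderiv_refMeshVel ha hb hΔt).mono fun ξ h => h.2))
  change lInfNorm (dom Ω₀ A Δt (n + 1)) (divergence (meshVel Ω₀ A Δt n)) ^ 2 ≤
    d * Λ ^ 2 * (lInfNorm Ω₀ (fderiv ℝ (refMeshVel A Δt n))
      * lInfNorm Ω₀ (fderiv ℝ (A (node Δt (n + 1))))
      * lInfNorm (dom Ω₀ A Δt (n + 1)) (divergence (meshVel Ω₀ A Δt n))) at hsq
  set D := lInfNorm (dom Ω₀ A Δt (n + 1)) (divergence (meshVel Ω₀ A Δt n))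
  set p := lInfNorm Ω₀ (fderiv ℝ (refMeshVel A Δt n))
      * lInfNorm Ω₀ (fderiv ℝ (A (node Δt (n + 1)))) * D with hp
  have h' : (2 * d * Λ ^ 2 + 1 : ℝ) * (Δt ^ 2 * p) ≤ 1 / 2 := by
    refine le_trans (le_of_eq ?_) h
    rw [hp]; ring
  have h1 : Δt ^ 2 * D ^ 2 ≤ Δt ^ 2 * (d * Λ ^ 2 * p) := by gcongr
  have hp0 : 0 ≤ Δt ^ 2 * p :=
    mul_nonneg (sq_nonneg _) (mul_nonneg (mul_nonneg lInfNorm_nonneg lInfNorm_nonneg)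
      lInfNorm_nonneg)
  have h2 : (Δt * D) ^ 2 ≤ (1 / 2) ^ 2 := by
    calc (Δt * D) ^ 2 = Δt ^ 2 * D ^ 2 := by ring
      _ ≤ d * Λ ^ 2 * (Δt ^ 2 * p) := by linarith
      _ ≤ (1 / 2) ^ 2 := by linarith
  exact (sq_le_sq₀ (mul_nonneg hΔt.le lInfNorm_nonneg) (by norm_num)).1 h2

end Step

theorem memLp_levelFun {d : ℕ} {Ω₀ : Set (E d)} {A : ℝ → E d → E d} {Δt : ℝ}
    (u₀ : Lp (E d) 2 (volume.restrict (dom Ω₀ A Δt 0)))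
    (u : (n : ℕ) → H10 (dom Ω₀ A Δt (n + 1))) :
    ∀ n, MemLp (levelFun u₀ u n) 2 (volume.restrict (dom Ω₀ A Δt n))
  | 0 => Lp.memLp u₀
  | n + 1 => Lp.memLp (toL2 (u n))

end ALEVMS
end

/-! ### The stability theorem. -/

set_option maxHeartbeats 800000 in
theorem lemma3 (d : ℕ) (Λ : ℝ≥0) :
    ∃ C : ℝ, 0 < C ∧
    ∀ (T L μ : ℝ), 0 < T → 0 ≤ L → 0 < μ →
    ∃ C' : ℝ, 0 < C' ∧
    ∀ (Ω₀ : Set (ALEVMS.E d)) (A : ℝ → ALEVMS.E d → ALEVMS.E d),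
      ALEVMS.IsALEMap Ω₀ T Λ A →
    ∀ (μT : ℝ), 0 ≤ μT →
    ∀ (ustar : ℝ → ALEVMS.E d → ALEVMS.E d),
      (∀ t ∈ Ioc 0 T, ∃ K : ℝ≥0, ALEVMS.W1InfBound K (A t '' Ω₀) (ustar t)) →
      (∀ t ∈ Ioc 0 T, ∀ q : ALEVMS.E d → ℝ, MemLp q 2 (volume.restrict (A t '' Ω₀)) →
        ∫ x in A t '' Ω₀, ALEVMS.divergence (ustar t) x * q x = 0) →
    ∀ (f : (t : ℝ) → ALEVMS.HMinus1 (A t '' Ω₀))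
      (N : ℕ) (Δt : ℝ), 0 < N → Δt = T / N →
      (∀ n < N, ALEVMS.lInfNorm Ω₀ (fderiv ℝ (ALEVMS.refMeshVel A Δt n)) ≤ L) →
    ∀ (Δtbar : ℝ),
      (∀ n < N,
        C * Δtbar ^ 2 * ALEVMS.lInfNorm Ω₀ (fderiv ℝ (ALEVMS.refMeshVel A Δt n))
            * ALEVMS.lInfNorm Ω₀ (fderiv ℝ (A (ALEVMS.node Δt (n + 1))))
            * ALEVMS.lInfNorm (ALEVMS.dom Ω₀ A Δt (n + 1))
                (ALEVMS.divergence (ALEVMS.meshVel Ω₀ A Δt n))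
          - Δtbar / 2 * ALEVMS.lInfNorm (ALEVMS.dom Ω₀ A Δt (n + 1))
              (ALEVMS.divergence (ustar (ALEVMS.node Δt (n + 1)))) ≤ 1 / 2) →
      Δt ≤ Δtbar →
    ∀ (S : (n : ℕ) → ALEVMS.VMSSpace (ALEVMS.dom Ω₀ A Δt (n + 1)))
      (u₀ : Lp (ALEVMS.E d) 2 (volume.restrict (ALEVMS.dom Ω₀ A Δt 0)))
      (uL uS : (n : ℕ) → ALEVMS.H10 (ALEVMS.dom Ω₀ A Δt (n + 1))),
      ALEVMS.IsBackwardEulerSolution Ω₀ A Δt N μ μT ustar f S u₀ uL uS →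
    ∀ n < N,
      ‖ALEVMS.toL2 (uL n + uS n)‖ ^ 2
        + 2 * μ * Δt * ∑ i ∈ Finset.range (n + 1), ‖ALEVMS.wgrad (uL i + uS i)‖ ^ 2
        + μT * Δt * ∑ i ∈ Finset.range (n + 1), ‖ALEVMS.wgrad (uS i)‖ ^ 2
      ≤ C' * (‖u₀‖ ^ 2
          + Δt * ∑ i ∈ Finset.range (n + 1), ‖f (ALEVMS.node Δt (i + 1))‖ ^ 2) := by
  open ALEVMS in
  obtain ⟨c, hc0, hc⟩ := exists_abs_det_one_sub_le d (2 * Λ * Λ)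
  refine ⟨2 * d * Λ ^ 2 + 1, by positivity, fun T L μ hT hL0 hμ => ?_⟩
  -- The first entry lets the viscosity absorb the gradient part of the force; the second keeps its
  -- mass part below `a/4` on long steps.
  set ε := min (2 * μ) (1 / (4 * T)) with hε
  have hε0 : 0 < ε := by positivity
  have hεμ : ε ≤ 2 * μ := min_le_left _ _
  have hεT : ε * T ≤ 1 / 4 := by
    calc ε * T ≤ 1 / (4 * T) * T := by gcongr; exact min_le_right _ _
      _ = 1 / 4 := by field_simp
  set κ := 2 * (c * (Λ * L) + d * (Λ * L) + ε) * (1 + Real.log (4 * (1 + c * (2 * Λ * Λ)))) with hκ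
  have hκ0 : 0 ≤ κ := by
    have h0 : 0 ≤ c * (2 * (Λ : ℝ) * Λ) := by positivity
    have h1 : 0 ≤ Real.log (4 * (1 + c * (2 * Λ * Λ))) := Real.log_nonneg (by linarith)
    positivity
  -- The 1 serves the initial value, `1/ε` the forces weighted by Young's inequality.
  refine ⟨Real.exp (κ * T) * max 1 (1 / ε), by positivity, ?_⟩
  intro Ω₀ A hA μT hμT ustar hus hus' f N Δt hN hΔtN hL Δtbar hbar hle S u₀ uL uS hsol n hn
  have hN' : (0 : ℝ) < N := Nat.cast_pos.2 hN
  have hΔt : 0 < Δt := by rw [hΔtN]; positivity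
  have hnT : ∀ k : ℕ, k ≤ N → k * Δt ≤ T := by
    intro k hk
    calc k * Δt ≤ N * Δt := by gcongr
      _ = T := by rw [hΔtN]; field_simp
  have hmem : ∀ k ≤ N, node Δt k ∈ Icc 0 T := fun k hk => ⟨by unfold node; positivity, hnT k hk⟩
  have hmem' : ∀ k < N, node Δt (k + 1) ∈ Ioc 0 T :=
    fun k hk => ⟨by unfold node; positivity, hnT _ hk⟩
  have hΔtT : Δt ≤ T := by simpa using hnT 1 hN
  set u : (k : ℕ) → H10 (dom Ω₀ A Δt (k + 1)) := fun k => uL k + uS k with hu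
  have hstep : ∀ k < N, (∫ x in dom Ω₀ A Δt (k + 1), ‖levelFun u₀ u (k + 1) x‖ ^ 2)
      + (2 * μ * Δt * ‖wgrad (u k)‖ ^ 2 + μT * Δt * ‖wgrad (uS k)‖ ^ 2) ≤
      Real.exp (κ * Δt) * ((∫ x in dom Ω₀ A Δt k, ‖levelFun u₀ u k x‖ ^ 2)
        + Δt * (‖f (node Δt (k + 1))‖ ^ 2 / ε)) := by
    intro k hk
    have ha := hA.isBiLipschitz (hmem k hk.le)
    have hb := hA.isBiLipschitz (hmem (k + 1) hk)
    obtain ⟨K, hK⟩ := hus _ (hmem' k hk)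
    have horth := hus' _ (hmem' k hk)
    have hdivus : lInfNorm (dom Ω₀ A Δt (k + 1)) (divergence (ustar (node Δt (k + 1)))) = 0 := by
      refine le_antisymm (lInfNorm_le le_rfl ?_) lInfNorm_nonneg
      filter_upwards [ae_divergence_eq_zero (C := d * K) (by
        filter_upwards [ae_restrict_mem hb.isOpen_image.measurableSet] with x hx
        refine (abs_divergence_le _ x).trans ?_
        gcongr
        exact hK.norm_fderiv_le hb.isOpen_image hx) horth] with x hx
      rw [hx, norm_zero]
    have hcond := hbar k hk
    rw [hdivus, mul_zero, sub_zero] at hcond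
    -- With `∇·u* = 0` the restriction is monotone in the step, so it passes from `Δtbar` to `Δt`.
    have hdiv := mul_lInfNorm_divergence_meshVel_le ha hb hΔt (le_trans (by
      gcongr <;> exact lInfNorm_nonneg) hcond)
    have h := backwardEuler_energy_step ha hb hc0 hc hΔt hΔtT hμT hε0 hεμ hεT (hL k hk) hdiv hK
      horth (f (node Δt (k + 1))) (u k) (uS k) (memLp_levelFun u₀ u k)
      (hsol.step k hk _ (hsol.large_mem k hk) _ (hsol.small_mem k hk))
    have e : ∫ x in dom Ω₀ A Δt (k + 1), ‖levelFun u₀ u (k + 1) x‖ ^ 2 = ‖toL2 (u k)‖ ^ 2 :=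
      (norm_sq_eq_integral _).symm
    rw [e, ← add_assoc]
    exact h
  have hgr := discrete_gronwall (a := fun k => ∫ x in dom Ω₀ A Δt k, ‖levelFun u₀ u k x‖ ^ 2)
    (D := fun k => 2 * μ * Δt * ‖wgrad (u k)‖ ^ 2 + μT * Δt * ‖wgrad (uS k)‖ ^ 2)
    (F := fun k => Δt * (‖f (node Δt (k + 1))‖ ^ 2 / ε)) (R := Real.exp (κ * Δt)) (N := N)
    (Real.one_le_exp (by positivity)) (fun k => by positivity) (fun k => by positivity) hstep
    (n + 1) hn
  have e0 : ∫ x in dom Ω₀ A Δt 0, ‖levelFun u₀ u 0 x‖ ^ 2 = ‖u₀‖ ^ 2 :=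
    (norm_sq_eq_integral _).symm
  have e1 : ∫ x in dom Ω₀ A Δt (n + 1), ‖levelFun u₀ u (n + 1) x‖ ^ 2 = ‖toL2 (u n)‖ ^ 2 :=
    (norm_sq_eq_integral _).symm
  simp only [e0, e1, Finset.sum_add_distrib, ← Finset.mul_sum, ← Finset.sum_div] at hgr
  rw [add_assoc]
  refine hgr.trans ?_
  rw [← Real.exp_nat_mul, mul_assoc (Real.exp (κ * T))]
  have hexp : ((n + 1 : ℕ) : ℝ) * (κ * Δt) ≤ κ * T := by
    calc ((n + 1 : ℕ) : ℝ) * (κ * Δt) = κ * (((n + 1 : ℕ) : ℝ) * Δt) := by ring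
      _ ≤ κ * T := by gcongr; exact hnT _ hn
  gcongr
  rw [mul_add]
  refine add_le_add (le_mul_of_one_le_left (sq_nonneg _) (le_max_left _ _)) ?_
  rw [div_eq_mul_one_div, ← mul_assoc, mul_comm]
  gcongr
  exact le_max_right _ _
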